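/- Let $g$ be a complex Lie algebra and $\mathcal F\in (Ug\otimes Ug)[[\lambda]]$ a Drinfeld twist: $\mathcal F$ is invertible, $\mathcal F_{12}(\Delta\otimes \mathrm{id})\mathcal F=\mathcal F_{23}(\mathrm{id}\otimes\Delta)\mathcal F$, $(\varepsilon\otimes \mathrm{id})\mathcal F=1=(\mathrm{id}\otimes\varepsilon)\mathcal F$ and $\mathcal F=1\otimes 1+O(\lambda)$, where $\Delta(t)=t\otimes 1+1\otimes t$ and $\varepsilon(t)=0$ for $t\in g$. Write $\mathcal F^{-1}=\bar f^\alpha\otimes\bar f_\alpha$, $\mathcal R=\mathcal F_{21}\mathcal F^{-1}$ and $\mathcal R^{-1}=\bar R^\alpha\otimes\bar R_\alpha$ (sums over $\alpha$ understood). Let $M$ be a smooth manifold, $A=C^\infty(M,\mathbb C)$, $\Xi$ the Lie algebra of complex vector fields on $M$, and $\rho:g\to\Xi$ a Lie algebra homomorphism. Through $\rho$ the algebra $Ug$ acts on functions, vector fields and 1-forms by iterated Lie derivatives. All spaces below are extended to formal power series in $\lambda$. Every bilinear map $\mu$ is deformed to $\mu_\star(x,y)=\mu(\bar f^\alpha(x),\bar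 f_\alpha(y))$; this defines the products $h\star v$ and $\omega\star h$ of functions with vector fields and 1-forms, the $\star$-Lie derivative of functions $\mathcal L^\star_u(h)=\bar f^\alpha(u)(\bar f_\alpha(h))$, the bracket $[u,v]_\star$, the pairing $\langle u,\omega\rangle_\star$ of vector fields with 1-forms, and the product $\omega\wedge_\star\omega'$. The exterior derivative $d$ is undeformed. Let $\nabla$ be a $\star$-covariant derivative on $M$: a map $(u,v)\mapsto\nabla_u v$ on $\Xi[[\lambda]]$, linear in both arguments, with $\nabla_{h\star u}v=h\star\nabla_u v$ and $\nabla_u(h\star v)=\mathcal L^\star_u(h)\star v+\bar R^\alpha(h)\star\nabla_{\bar R_\alpha(u)}v$. Its torsion and curvature are $$T(u,v)=\nabla_u v-\nabla_{\bar R^\alpha(v)}\bar R_\alpha(u)-[u,v]_\star,$$ $$R(u,v,z)=\nabla_u\nabla_v z-\nabla_{\bar R^\alpha(v)}\nabla_{\bar R_\alpha(u)}z-\nabla_{[u,v]_\star}z.$$ Let $W\subseteq M$ be open. All the above restricts to $W$. Let $\{e_i\}$ be a frame of vector fields on $W$ (formal corrections in $\lambda$ are allowed: the terms of order $\lambda^0$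 form an ordinary frame), and let $\{\theta^j\}$ be the $\star$-dual frame of 1-forms, $\langle e_i,\theta^j\rangle_\star=\delta_i^j$. With summation over repeated indices, define $\Gamma_{ij}^k$ by $\nabla_{e_i}e_j=\Gamma_{ij}^k\star e_k$, put $$T_{ij}{}^l=\langle T(e_i,e_j),\theta^l\rangle_\star,\qquad R_{ijk}{}^l=\langle R(e_i,e_j,e_k),\theta^l\rangle_\star,$$ and define the connection, torsion and curvature forms on $W$ by $$\omega_i{}^j=\theta^k\star\Gamma_{ki}^j,\qquad \Theta^l=-\tfrac12\,\theta^j\wedge_\star\theta^i\star T_{ij}{}^l,\qquad \Omega_k{}^l=-\tfrac12\,\theta^j\wedge_\star\theta^i\star R_{ijk}{}^l .$$ Then the Cartan structural equations hold for all $k,l$: $$\Theta^l=d\theta^l-\theta^k\wedge_\star\omega_k{}^l,\qquad \Omega_k{}^l=d\omega_k{}^l-\omega_k{}^m\wedge_\star\omega_m{}^l .$$ -/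

import Mathlib

open scoped TensorProduct

noncomputable section

namespace StarGeometry

/-! ## Formal power series with coefficients in a vector space -/

/-- `X[[λ]]`: formal power series in the deformation parameter with coefficients in `X`,
stored as the sequence of coefficients. -/
def Formal (X : Type*) : Type _ := ℕ → X

instance {X : Type*} [AddCommGroup X] : AddCommGroup (Formal X) :=
  inferInstanceAs (AddCommGroup (ℕ → X))

instance {X : Type*} [AddCommGroup X] [Module ℂ X] : Module ℂ (Formal X) :=
  inferInstanceAs (Module ℂ (ℕ → X))

namespace Formal

/-- The series `x + 0 λ + 0 λ² + ⋯`. -/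
def const {X : Type*} [AddCommGroup X] (x : X) : Formal X := fun n => if n = 0 then x else 0

/-- Coefficientwise extension of a linear map to formal series. -/
def map {X Y : Type*} [AddCommGroup X] [Module ℂ X] [AddCommGroup Y] [Module ℂ Y]
    (f : X →ₗ[ℂ] Y) : Formal X →ₗ[ℂ] Formal Y where
  toFun x := fun n => f (x n)
  map_add' x y := funext fun n => f.map_add (x n) (y n)
  map_smul' c x := funext fun n => f.map_smul c (x n)

theorem ext {X : Type*} {x y : Formal X} (h : ∀ n, x n = y n) : x = y := funext h

variable {X Y Z : Type*} [AddCommGroup X] [AddCommGroup Y] [AddCommGroup Z]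

theorem add_apply (x y : Formal X) (n : ℕ) : (x + y) n = x n + y n := rfl
theorem sub_apply (x y : Formal X) (n : ℕ) : (x - y) n = x n - y n := rfl
theorem zero_apply (n : ℕ) : (0 : Formal X) n = 0 := rfl

variable [Module ℂ X] [Module ℂ Y] [Module ℂ Z]

theorem smul_apply (c : ℂ) (x : Formal X) (n : ℕ) : (c • x) n = c • x n := rfl
theorem map_apply (f : X →ₗ[ℂ] Y) (x : Formal X) (n : ℕ) : map f x n = f (x n) := rfl

/-- Extension of a bilinear map `μ` to formal series by the Cauchy product:
`μ(∑ λⁱ xᵢ, ∑ λʲ yⱼ) = ∑ λⁱ⁺ʲ μ(xᵢ, yⱼ)`. -/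
def bilin (μ : X →ₗ[ℂ] Y →ₗ[ℂ] Z) : Formal X →ₗ[ℂ] Formal Y →ₗ[ℂ] Formal Z :=
  LinearMap.mk₂ ℂ (fun x y n => ∑ p ∈ Finset.HasAntidiagonal.antidiagonal n, μ (x p.1) (y p.2))
    (fun x x' y => funext fun n => by
      simp only [add_apply, map_add, LinearMap.add_apply, Finset.sum_add_distrib]; rfl)
    (fun c x y => funext fun n => by
      simp only [smul_apply, map_smul, LinearMap.smul_apply, ← Finset.smul_sum]; rfl)
    (fun x y y' => funext fun n => by
      simp only [add_apply, map_add, Finset.sum_add_distrib]; rfl)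
    (fun c x y => funext fun n => by
      simp only [smul_apply, map_smul, ← Finset.smul_sum]; rfl)

theorem bilin_apply (μ : X →ₗ[ℂ] Y →ₗ[ℂ] Z) (x : Formal X) (y : Formal Y) (n : ℕ) :
    bilin μ x y n = ∑ p ∈ Finset.HasAntidiagonal.antidiagonal n, μ (x p.1) (y p.2) := rfl

end Formal

/-! ## Universal enveloping algebra, coproduct, twists -/

section Twist

variable (g : Type*) [LieRing g] [LieAlgebra ℂ g]

/-- `Ug`. -/
abbrev Ug : Type _ := UniversalEnvelopingAlgebra ℂ g

attribute [local instance] LieRing.ofAssociativeRing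

/-- The coproduct of `Ug`, determined by `Δ(t) = t ⊗ 1 + 1 ⊗ t` for `t ∈ g`. -/
def comul : Ug g →ₐ[ℂ] Ug g ⊗[ℂ] Ug g :=
  UniversalEnvelopingAlgebra.lift ℂ
    { toFun := fun t => UniversalEnvelopingAlgebra.ι ℂ t ⊗ₜ[ℂ] 1 +
        1 ⊗ₜ[ℂ] UniversalEnvelopingAlgebra.ι ℂ t
      map_add' := fun s t => by
        simp only [map_add, TensorProduct.add_tmul, TensorProduct.tmul_add]; abel
      map_smul' := fun c t => by
        simp only [map_smul, TensorProduct.smul_tmul', TensorProduct.tmul_smul, smul_add,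
          RingHom.id_apply]
      map_lie' := fun {s t} => by
        simp only [LieHom.map_lie, LieRing.of_associative_ring_bracket, mul_add, add_mul,
          Algebra.TensorProduct.tmul_mul_tmul, one_mul, mul_one, TensorProduct.sub_tmul,
          TensorProduct.tmul_sub]
        abel }

/-- The counit of `Ug`, determined by `ε(t) = 0` for `t ∈ g`. -/
def counit : Ug g →ₐ[ℂ] ℂ := UniversalEnvelopingAlgebra.lift ℂ (0 : g →ₗ⁅ℂ⁆ ℂ)

/-- `(Ug ⊗ Ug)[[λ]]`, in which the twist and the universal `R`-matrix live. -/
abbrev UU : Type _ := PowerSeries (Ug g ⊗[ℂ] Ug g)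

/-- The flip `ξ ⊗ ζ ↦ ζ ⊗ ξ` on `(Ug ⊗ Ug)[[λ]]`. -/
def flipUU : UU g →+* UU g :=
  PowerSeries.map (Algebra.TensorProduct.comm ℂ (Ug g) (Ug g)).toAlgHom.toRingHom

/-- A Drinfeld twist: an invertible `𝓕 ∈ (Ug ⊗ Ug)[[λ]]` with
`𝓕₁₂ (Δ ⊗ id)𝓕 = 𝓕₂₃ (id ⊗ Δ)𝓕`, `(ε ⊗ id)𝓕 = 1 = (id ⊗ ε)𝓕` and `𝓕 = 1 ⊗ 1 + O(λ)`. -/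
structure Twist where
  F : (UU g)ˣ
  cocycle :
    PowerSeries.map (Algebra.TensorProduct.assoc ℂ ℂ ℂ (Ug g) (Ug g) (Ug g)).toAlgHom.toRingHom
      (PowerSeries.map (Algebra.TensorProduct.includeLeft :
          Ug g ⊗[ℂ] Ug g →ₐ[ℂ] (Ug g ⊗[ℂ] Ug g) ⊗[ℂ] Ug g).toRingHom (F : UU g) *
        PowerSeries.map (Algebra.TensorProduct.map (comul g) (AlgHom.id ℂ (Ug g))).toRingHom
          (F : UU g)) =
    PowerSeries.map (Algebra.TensorProduct.includeRight :
        Ug g ⊗[ℂ] Ug g →ₐ[ℂ] Ug g ⊗[ℂ] (Ug g ⊗[ℂ] Ug g)).toRingHom (F : UU g) *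
      PowerSeries.map (Algebra.TensorProduct.map (AlgHom.id ℂ (Ug g)) (comul g)).toRingHom
        (F : UU g)
  counit_left :
    PowerSeries.map ((Algebra.TensorProduct.lid ℂ (Ug g)).toAlgHom.comp
      (Algebra.TensorProduct.map (counit g) (AlgHom.id ℂ (Ug g)))).toRingHom (F : UU g) = 1
  counit_right :
    PowerSeries.map ((Algebra.TensorProduct.rid ℂ ℂ (Ug g)).toAlgHom.comp
      (Algebra.TensorProduct.map (AlgHom.id ℂ (Ug g)) (counit g))).toRingHom (F : UU g) = 1
  constantCoeff_eq : PowerSeries.constantCoeff (F : UU g) = 1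

variable {g}

/-- `𝓕⁻¹ = f̄^α ⊗ f̄_α`. -/
def Twist.inv (F : Twist g) : UU g := (F.F⁻¹ : (UU g)ˣ)

/-- The universal `R`-matrix `𝓡 = 𝓕₂₁ 𝓕⁻¹`. -/
def Twist.R (F : Twist g) : (UU g)ˣ := Units.map (flipUU g).toMonoidHom F.F * F.F⁻¹

/-- `𝓡⁻¹ = R̄^α ⊗ R̄_α`. -/
def Twist.Rinv (F : Twist g) : UU g := (F.R⁻¹ : (UU g)ˣ)

end Twist

/-! ## Vector fields and forms over a commutative algebra -/

section Calculus

variable (A : Type*) [CommRing A] [Algebra ℂ A]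

/-- Vector fields: derivations of the algebra of functions. -/
abbrev VF : Type _ := Derivation ℂ A A

/-- 1-forms: function-linear functionals on vector fields. -/
abbrev OneForm : Type _ := VF A →ₗ[A] A

/-- 2-forms: function-bilinear alternating functionals on vector fields. -/
abbrev TwoForm : Type _ := VF A [⋀^Fin 2]→ₗ[A] A

variable {A}

theorem lie_smul_VF (X Y : VF A) (f : A) : ⁅X, f • Y⁆ = X f • Y + f • ⁅X, Y⁆ := by
  ext a
  simp only [Derivation.commutator_apply, Derivation.smul_apply, Derivation.add_apply,
    smul_eq_mul, Derivation.leibniz]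
  ring

theorem smul_lie_VF (X Y : VF A) (f : A) : ⁅f • X, Y⁆ = f • ⁅X, Y⁆ - Y f • X := by
  ext a
  simp only [Derivation.commutator_apply, Derivation.smul_apply, Derivation.sub_apply,
    smul_eq_mul, Derivation.leibniz]
  ring

/-- The Lie derivative `(L_X ω)(Y) = X(ω(Y)) - ω([X, Y])` of 1-forms. -/
def lieDeriv (X : VF A) (ω : OneForm A) : OneForm A where
  toFun Y := X (ω Y) - ω ⁅X, Y⁆
  map_add' Y Y' := by simp only [map_add, lie_add]; ring
  map_smul' f Y := by
    simp only [lie_smul_VF, map_smul, map_add, smul_eq_mul, Derivation.leibniz, RingHom.id_apply]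
    ring

theorem lieDeriv_apply (X : VF A) (ω : OneForm A) (Y : VF A) :
    lieDeriv X ω Y = X (ω Y) - ω ⁅X, Y⁆ := rfl

/-- Vector fields act on 1-forms by the Lie derivative. -/
instance : LieRingModule (VF A) (OneForm A) where
  bracket := lieDeriv
  add_lie X X' ω := by
    ext Y
    change lieDeriv (X + X') ω Y = lieDeriv X ω Y + lieDeriv X' ω Y
    simp only [lieDeriv_apply, Derivation.add_apply, add_lie, map_add]; ring
  lie_add X ω ω' := by
    ext Y
    change lieDeriv X (ω + ω') Y = lieDeriv X ω Y + lieDeriv X ω' Y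
    simp only [lieDeriv_apply, LinearMap.add_apply, map_add]; ring
  leibniz_lie X X' ω := by
    ext Y
    change lieDeriv X (lieDeriv X' ω) Y =
      lieDeriv ⁅X, X'⁆ ω Y + lieDeriv X' (lieDeriv X ω) Y
    simp only [lieDeriv_apply, Derivation.commutator_apply, map_sub, lie_lie]
    ring

instance : LieModule ℂ (VF A) (OneForm A) where
  smul_lie c X ω := by
    ext Y
    change lieDeriv (c • X) ω Y = c • lieDeriv X ω Y
    simp only [lieDeriv_apply, Derivation.smul_apply, smul_lie, LinearMap.map_smul_of_tower,
      smul_sub]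
  lie_smul c X ω := by
    ext Y
    change lieDeriv X (c • ω) Y = c • lieDeriv X ω Y
    simp only [lieDeriv_apply, LinearMap.smul_apply, Derivation.map_smul, smul_sub]

/-- The wedge product of 1-forms, `(ω ∧ η)(X, Y) = ω(X) η(Y) - ω(Y) η(X)`. -/
def wedgeForm (ω η : OneForm A) : TwoForm A where
  toFun v := ω (v 0) * η (v 1) - ω (v 1) * η (v 0)
  map_update_add' v i x y := by
    fin_cases i <;> simp [Function.update] <;> ring
  map_update_smul' v i c x := by
    fin_cases i <;> simp [Function.update] <;> ring
  map_eq_zero_of_eq' v i j h hij := by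
    fin_cases i <;> fin_cases j <;> simp_all

/-- The exterior derivative of 1-forms, `(dω)(X, Y) = X(ω(Y)) - Y(ω(X)) - ω([X, Y])`. -/
def dForm (ω : OneForm A) : TwoForm A where
  toFun v := v 0 (ω (v 1)) - v 1 (ω (v 0)) - ω ⁅v 0, v 1⁆
  map_update_add' v i x y := by
    fin_cases i <;> simp [Function.update] <;> ring
  map_update_smul' v i c x := by
    fin_cases i
    · simp only [Fin.zero_eta, Function.update_self, ne_eq, one_ne_zero, not_false_eq_true,
        Function.update_of_ne]
      rw [smul_lie_VF]
      simp; ring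
    · simp only [Fin.mk_one, Function.update_self, ne_eq, zero_ne_one, not_false_eq_true,
        Function.update_of_ne]
      rw [lie_smul_VF]
      simp; ring
  map_eq_zero_of_eq' v i j h hij := by
    fin_cases i <;> fin_cases j <;> simp_all

/-- `h, k ↦ h k`. -/
def mulFun : A →ₗ[ℂ] A →ₗ[ℂ] A := LinearMap.mul ℂ A

/-- `h, v ↦ h v` for a function `h` and a vector field `v`. -/
def smulVF : A →ₗ[ℂ] VF A →ₗ[ℂ] VF A :=
  LinearMap.mk₂ ℂ (fun h v => h • v) add_smul (fun c h v => smul_assoc c h v) smul_add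
    (fun c h v => smul_comm h c v)

/-- `ω, h ↦ ω h` for a 1-form `ω` and a function `h`. -/
def mulForm : OneForm A →ₗ[ℂ] A →ₗ[ℂ] OneForm A :=
  LinearMap.mk₂ ℂ (fun ω h => h • ω) (fun _ _ _ => smul_add _ _ _) (fun c ω h => smul_comm h c ω)
    (fun _ _ _ => add_smul _ _ _) (fun c ω h => smul_assoc c h ω)

/-- The action `u, h ↦ u(h)` of vector fields on functions. -/
def applyVF : VF A →ₗ[ℂ] A →ₗ[ℂ] A :=
  LinearMap.mk₂ ℂ (fun u h => u h) (fun _ _ _ => rfl) (fun _ _ _ => rfl) (fun u => u.map_add)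
    (fun c u h => u.map_smul c h)

/-- The Lie bracket of vector fields. -/
def bracketVF : VF A →ₗ[ℂ] VF A →ₗ[ℂ] VF A :=
  LinearMap.mk₂ ℂ (fun u v => ⁅u, v⁆) add_lie smul_lie lie_add (fun c u v => lie_smul c u v)

/-- The pairing `v, ω ↦ ⟨v, ω⟩ = ω(v)`. -/
def pairing : VF A →ₗ[ℂ] OneForm A →ₗ[ℂ] A :=
  LinearMap.mk₂ ℂ (fun v ω => ω v) (fun _ _ ω => ω.map_add _ _)
    (fun c v ω => ω.map_smul_of_tower c v) (fun _ _ _ => rfl) (fun _ _ _ => rfl)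

/-- The wedge product of 1-forms as a bilinear map. -/
def wedge : OneForm A →ₗ[ℂ] OneForm A →ₗ[ℂ] TwoForm A :=
  LinearMap.mk₂ ℂ wedgeForm
    (fun _ _ _ => by ext v; simp [wedgeForm]; ring)
    (fun c _ _ => by ext v; simp [wedgeForm, smul_sub])
    (fun _ _ _ => by ext v; simp [wedgeForm]; ring)
    (fun c _ _ => by ext v; simp [wedgeForm, smul_sub])

/-- The exterior derivative of 1-forms as a linear map. -/
def extD : OneForm A →ₗ[ℂ] TwoForm A where
  toFun := dForm
  map_add' _ _ := by ext v; simp [dForm]; ring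
  map_smul' c _ := by ext v; simp [dForm, smul_sub]

end Calculus

/-! ## Twisting bilinear maps -/

section Star

variable {g : Type*} [LieRing g] [LieAlgebra ℂ g] {A : Type*} [CommRing A] [Algebra ℂ A]

attribute [local instance] LieRing.ofAssociativeRing

/-- The action of `Ug` on a space `X` of functions, vector fields or 1-forms: iterated Lie
derivative along the vector fields `ρ(t)`, `t ∈ g`. -/
def act (ρ : g →ₗ⁅ℂ⁆ VF A) (X : Type*) [AddCommGroup X] [Module ℂ X] [LieRingModule (VF A) X]
    [LieModule ℂ (VF A) X] : Ug g →ₐ[ℂ] Module.End ℂ X :=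
  UniversalEnvelopingAlgebra.lift ℂ ((LieModule.toEnd ℂ (VF A) X).comp ρ)

/-- The coefficientwise action of `Ug` on `X[[λ]]`. -/
def formalAct (ρ : g →ₗ⁅ℂ⁆ VF A) (X : Type*) [AddCommGroup X] [Module ℂ X]
    [LieRingModule (VF A) X] [LieModule ℂ (VF A) X] :
    Ug g →ₗ[ℂ] Formal X →ₗ[ℂ] Formal X where
  toFun a := Formal.map (act ρ X a)
  map_add' a b := by
    ext x; refine Formal.ext fun n => ?_
    simp only [Formal.map_apply, map_add, LinearMap.add_apply, Formal.add_apply]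
  map_smul' c a := by
    ext x; refine Formal.ext fun n => ?_
    simp only [Formal.map_apply, map_smul, LinearMap.smul_apply, Formal.smul_apply,
      RingHom.id_apply]

variable {X Y Z : Type*} [AddCommGroup X] [Module ℂ X] [LieRingModule (VF A) X]
  [LieModule ℂ (VF A) X] [AddCommGroup Y] [Module ℂ Y] [LieRingModule (VF A) Y]
  [LieModule ℂ (VF A) Y] [AddCommGroup Z] [Module ℂ Z]

/-- For `ξ = ∑ aₛ ⊗ bₛ ∈ Ug ⊗ Ug`, the value `∑ B(aₛ(x), bₛ(y))`. -/
def twistTerm (ρ : g →ₗ⁅ℂ⁆ VF A) (B : Formal X →ₗ[ℂ] Formal Y →ₗ[ℂ] Z) (x : Formal X)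
    (y : Formal Y) : Ug g ⊗[ℂ] Ug g →ₗ[ℂ] Z :=
  TensorProduct.lift (B.compl₁₂ ((formalAct ρ X).flip x) ((formalAct ρ Y).flip y))

theorem twistTerm_tmul (ρ : g →ₗ⁅ℂ⁆ VF A) (B : Formal X →ₗ[ℂ] Formal Y →ₗ[ℂ] Z) (x : Formal X)
    (y : Formal Y) (a b : Ug g) :
    twistTerm ρ B x y (a ⊗ₜ b) = B (formalAct ρ X a x) (formalAct ρ Y b y) := by
  simp [twistTerm]

/-- The composition of a bilinear map `B` on formal series with the action of
`ξ = ∑ₖ λᵏ ξₖ ∈ (Ug ⊗ Ug)[[λ]]`: writing `ξ = ξ^α ⊗ ξ_α`, this is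
`(x, y) ↦ B(ξ^α(x), ξ_α(y)) = ∑ₖ λᵏ B(ξₖ^α(x), ξₖ_α(y))`. -/
def twist (ρ : g →ₗ⁅ℂ⁆ VF A) (ξ : UU g) (B : Formal X →ₗ[ℂ] Formal Y →ₗ[ℂ] Formal Z) :
    Formal X →ₗ[ℂ] Formal Y →ₗ[ℂ] Formal Z :=
  LinearMap.mk₂ ℂ
    (fun x y n => ∑ p ∈ Finset.HasAntidiagonal.antidiagonal n,
      twistTerm ρ B x y (PowerSeries.coeff p.1 ξ) p.2)
    (fun x x' y => funext fun n => by
      have h : twistTerm ρ B (x + x') y = twistTerm ρ B x y + twistTerm ρ B x' y := by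
        ext a b; simp [twistTerm_tmul]
      simp only [h, LinearMap.add_apply, Formal.add_apply, Finset.sum_add_distrib]; rfl)
    (fun c x y => funext fun n => by
      have h : twistTerm ρ B (c • x) y = c • twistTerm ρ B x y := by
        ext a b; simp [twistTerm_tmul]
      simp only [h, LinearMap.smul_apply, Formal.smul_apply, ← Finset.smul_sum]; rfl)
    (fun x y y' => funext fun n => by
      have h : twistTerm ρ B x (y + y') = twistTerm ρ B x y + twistTerm ρ B x y' := by
        ext a b; simp [twistTerm_tmul]
      simp only [h, LinearMap.add_apply, Formal.add_apply, Finset.sum_add_distrib]; rfl)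
    (fun c x y => funext fun n => by
      have h : twistTerm ρ B x (c • y) = c • twistTerm ρ B x y := by
        ext a b; simp [twistTerm_tmul]
      simp only [h, LinearMap.smul_apply, Formal.smul_apply, ← Finset.smul_sum]; rfl)

theorem twist_apply (ρ : g →ₗ⁅ℂ⁆ VF A) (ξ : UU g)
    (B : Formal X →ₗ[ℂ] Formal Y →ₗ[ℂ] Formal Z) (x : Formal X) (y : Formal Y) (n : ℕ) :
    twist ρ ξ B x y n = ∑ p ∈ Finset.HasAntidiagonal.antidiagonal n,
      twistTerm ρ B x y (PowerSeries.coeff p.1 ξ) p.2 := rfl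

/-- The ⋆-deformation `μ_⋆ = μ ∘ 𝓕⁻¹` of a bilinear map `μ`. -/
def starMap (F : Twist g) (ρ : g →ₗ⁅ℂ⁆ VF A) (μ : X →ₗ[ℂ] Y →ₗ[ℂ] Z) :
    Formal X →ₗ[ℂ] Formal Y →ₗ[ℂ] Formal Z :=
  twist ρ F.inv (Formal.bilin μ)

/-! ## ⋆-covariant derivatives, torsion and curvature -/

variable (F : Twist g) (ρ : g →ₗ⁅ℂ⁆ VF A)

/-- A ⋆-covariant derivative `u, v ↦ ∇_u v`. Linearity over `ℂ[[λ]]` follows from the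
axioms applied to constant `h`. -/
structure StarConnection where
  nabla : Formal (VF A) →ₗ[ℂ] Formal (VF A) →ₗ[ℂ] Formal (VF A)
  /-- `∇_{h ⋆ u} v = h ⋆ ∇_u v` -/
  smul_left : ∀ (h : Formal A) (u v : Formal (VF A)),
    nabla (starMap F ρ smulVF h u) v = starMap F ρ smulVF h (nabla u v)
  /-- `∇_u (h ⋆ v) = 𝓛⋆_u(h) ⋆ v + R̄^α(h) ⋆ ∇_{R̄_α(u)} v` -/
  leibniz : ∀ (u : Formal (VF A)) (h : Formal A) (v : Formal (VF A)),
    nabla u (starMap F ρ smulVF h v) =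
      starMap F ρ smulVF (starMap F ρ applyVF u h) v +
        twist ρ F.Rinv ((starMap F ρ smulVF).compl₂ (nabla.flip v)) h u

variable {F ρ}

/-- `T(u, v) = ∇_u v - ∇_{R̄^α(v)} R̄_α(u) - [u, v]_⋆`. -/
def StarConnection.torsion (D : StarConnection F ρ) (u v : Formal (VF A)) : Formal (VF A) :=
  D.nabla u v - twist ρ F.Rinv D.nabla v u - starMap F ρ bracketVF u v

/-- `R(u, v, z) = ∇_u ∇_v z - ∇_{R̄^α(v)} ∇_{R̄_α(u)} z - ∇_{[u, v]_⋆} z`. -/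
def StarConnection.curvature (D : StarConnection F ρ) (u v z : Formal (VF A)) :
    Formal (VF A) :=
  D.nabla u (D.nabla v z) - twist ρ F.Rinv (D.nabla.compl₂ (D.nabla.flip z)) v u -
    D.nabla (starMap F ρ bracketVF u v) z

variable {ι : Type*} [Fintype ι]

/-- A frame of vector fields (with formal corrections in `λ`): the classical limits of the `e i`
form a basis of the vector fields over the functions. -/
def IsFrame (e : ι → Formal (VF A)) : Prop :=
  LinearIndependent A (fun i => e i 0) ∧ Submodule.span A (Set.range fun i => e i 0) = ⊤

variable (F ρ)

/-- `θ` is ⋆-dual to `e`: `⟨e_i, θ^j⟩_⋆ = δ_i^j`. -/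
def IsStarDual [DecidableEq ι] (e : ι → Formal (VF A)) (θ : ι → Formal (OneForm A)) : Prop :=
  ∀ i j, starMap F ρ pairing (e i) (θ j) = Formal.const (if i = j then 1 else 0)

variable {F ρ}

/-- `Γ i j k = Γ_{ij}^k` are the connection coefficients: `∇_{e_i} e_j = ∑ₖ Γ_{ij}^k ⋆ e_k`. -/
def IsConnectionCoeff (D : StarConnection F ρ) (e : ι → Formal (VF A))
    (Γ : ι → ι → ι → Formal A) : Prop :=
  ∀ i j, D.nabla (e i) (e j) = ∑ k, starMap F ρ smulVF (Γ i j k) (e k)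

variable (F ρ)

/-- The connection forms `ω_i^j = ∑ₖ θ^k ⋆ Γ_{ki}^j`. -/
def connectionForm (θ : ι → Formal (OneForm A)) (Γ : ι → ι → ι → Formal A) (i j : ι) :
    Formal (OneForm A) :=
  ∑ k, starMap F ρ mulForm (θ k) (Γ k i j)

variable {F ρ}

/-- `T_{ij}^l = ⟨T(e_i, e_j), θ^l⟩_⋆`. -/
def StarConnection.torsionCoeff (D : StarConnection F ρ) (e : ι → Formal (VF A))
    (θ : ι → Formal (OneForm A)) (i j l : ι) : Formal A :=
  starMap F ρ pairing (D.torsion (e i) (e j)) (θ l)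

/-- `R_{ijk}^l = ⟨R(e_i, e_j, e_k), θ^l⟩_⋆`. -/
def StarConnection.curvatureCoeff (D : StarConnection F ρ) (e : ι → Formal (VF A))
    (θ : ι → Formal (OneForm A)) (i j k l : ι) : Formal A :=
  starMap F ρ pairing (D.curvature (e i) (e j) (e k)) (θ l)

/-- The torsion forms `Θ^l = -½ ∑ θ^j ∧_⋆ θ^i ⋆ T_{ij}^l`. -/
def StarConnection.torsionForm (D : StarConnection F ρ) (e : ι → Formal (VF A))
    (θ : ι → Formal (OneForm A)) (l : ι) : Formal (TwoForm A) :=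
  -(1 / 2 : ℂ) • ∑ i, ∑ j,
    starMap F ρ wedge (θ j) (starMap F ρ mulForm (θ i) (D.torsionCoeff e θ i j l))

/-- The curvature forms `Ω_k^l = -½ ∑ θ^j ∧_⋆ θ^i ⋆ R_{ijk}^l`. -/
def StarConnection.curvatureForm (D : StarConnection F ρ) (e : ι → Formal (VF A))
    (θ : ι → Formal (OneForm A)) (k l : ι) : Formal (TwoForm A) :=
  -(1 / 2 : ℂ) • ∑ i, ∑ j,
    starMap F ρ wedge (θ j) (starMap F ρ mulForm (θ i) (D.curvatureCoeff e θ i j k l))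

end Star

/-! ## Auxiliary facts about twisted maps -/

section Aux

variable {g : Type*} [LieRing g] [LieAlgebra ℂ g]

attribute [local instance] LieRing.ofAssociativeRing

theorem U_induction (S : Subalgebra ℂ (Ug g)) (h : ∀ t, UniversalEnvelopingAlgebra.ι ℂ t ∈ S)
    (a : Ug g) : a ∈ S := by
  let φ : g →ₗ⁅ℂ⁆ S :=
    { toFun := fun t => ⟨UniversalEnvelopingAlgebra.ι ℂ t, h t⟩
      map_add' := fun s t => Subtype.ext (map_add _ s t)
      map_smul' := fun c t => Subtype.ext (map_smul _ c t)
      map_lie' := fun {s t} => Subtype.ext (LieHom.map_lie _ s t) }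
  have h1 : S.val.comp (UniversalEnvelopingAlgebra.lift ℂ φ) = AlgHom.id ℂ (Ug g) := by
    apply UniversalEnvelopingAlgebra.hom_ext
    ext t
    simp [φ]
  have h2 := DFunLike.congr_fun h1 a
  rw [AlgHom.id_apply] at h2
  rw [← h2]
  exact (UniversalEnvelopingAlgebra.lift ℂ φ a).2

variable {A : Type*} [CommRing A] [Algebra ℂ A] {A' : Type*} [CommRing A'] [Algebra ℂ A']

variable {X Y Z : Type*} [AddCommGroup X] [Module ℂ X] [LieRingModule (VF A) X]
  [LieModule ℂ (VF A) X] [AddCommGroup Y] [Module ℂ Y] [LieRingModule (VF A) Y]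
  [LieModule ℂ (VF A) Y] [AddCommGroup Z] [Module ℂ Z]
  {X' Y' Z' : Type*} [AddCommGroup X'] [Module ℂ X'] [LieRingModule (VF A') X']
  [LieModule ℂ (VF A') X'] [AddCommGroup Y'] [Module ℂ Y'] [LieRingModule (VF A') Y']
  [LieModule ℂ (VF A') Y'] [AddCommGroup Z'] [Module ℂ Z']
  (ρ : g →ₗ⁅ℂ⁆ VF A) (ρ' : g →ₗ⁅ℂ⁆ VF A')

theorem act_ι (t : g) (x : X) : act ρ X (UniversalEnvelopingAlgebra.ι ℂ t) x = ⁅ρ t, x⁆ := by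
  simp [act]

theorem act_mem (P : Submodule ℂ X) (h : ∀ v : VF A, ∀ x ∈ P, ⁅v, x⁆ ∈ P) (a : Ug g) :
    ∀ x ∈ P, act ρ X a x ∈ P := by
  let S : Subalgebra ℂ (Ug g) :=
    { carrier := {a | ∀ x ∈ P, act ρ X a x ∈ P}
      mul_mem' := fun {a b} ha hb x hx => by
        rw [map_mul]; exact ha _ (hb x hx)
      add_mem' := fun {a b} ha hb x hx => by
        rw [map_add]; exact P.add_mem (ha x hx) (hb x hx)
      algebraMap_mem' := fun c x hx => by
        rw [AlgHom.commutes, Module.algebraMap_end_apply]; exact P.smul_mem c hx }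
  exact U_induction S (fun t x hx => by rw [act_ι]; exact h _ x hx) a

theorem act_map (f : X →ₗ[ℂ] X') (h : ∀ t x, f ⁅ρ t, x⁆ = ⁅ρ' t, f x⁆) (a : Ug g) :
    ∀ x, f (act ρ X a x) = act ρ' X' a (f x) := by
  let S : Subalgebra ℂ (Ug g) :=
    { carrier := {a | ∀ x, f (act ρ X a x) = act ρ' X' a (f x)}
      mul_mem' := fun {a b} ha hb x => by
        rw [map_mul, map_mul, Module.End.mul_apply, Module.End.mul_apply, ha, hb]
      add_mem' := fun {a b} ha hb x => by
        rw [map_add, map_add, LinearMap.add_apply, LinearMap.add_apply, map_add, ha, hb]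
      algebraMap_mem' := fun c x => by
        rw [AlgHom.commutes, AlgHom.commutes, Module.algebraMap_end_apply,
          Module.algebraMap_end_apply, map_smul] }
  exact U_induction S (fun t x => by rw [act_ι, act_ι]; exact h t x) a

/-- Formal series with all coefficients in `P`. -/
def Formal.sub (P : Submodule ℂ X) : Submodule ℂ (Formal X) where
  carrier := {x | ∀ n, x n ∈ P}
  add_mem' hx hy n := P.add_mem (hx n) (hy n)
  zero_mem' _ := P.zero_mem
  smul_mem' c _ hx n := P.smul_mem c (hx n)

theorem bilin_mem (μ : X →ₗ[ℂ] Y →ₗ[ℂ] Z) (Q : Submodule ℂ Z) {x : Formal X} {y : Formal Y}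
    (h : ∀ i j, μ (x i) (y j) ∈ Q) : Formal.bilin μ x y ∈ Formal.sub Q := fun n => by
  rw [Formal.bilin_apply]
  exact Submodule.sum_mem _ fun p _ => h _ _

theorem twist_mem (ξ : UU g) (B : Formal X →ₗ[ℂ] Formal Y →ₗ[ℂ] Formal Z) (Q : Submodule ℂ Z)
    {x : Formal X} {y : Formal Y}
    (h : ∀ a b, B (formalAct ρ X a x) (formalAct ρ Y b y) ∈ Formal.sub Q) :
    twist ρ ξ B x y ∈ Formal.sub Q := by
  have h1 : ∀ ζ, twistTerm ρ B x y ζ ∈ Formal.sub Q := by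
    intro ζ
    induction ζ using TensorProduct.induction_on with
    | zero => rw [map_zero]; exact Submodule.zero_mem _
    | tmul a b => rw [twistTerm_tmul]; exact h a b
    | add ζ ζ' h1 h2 => rw [map_add]; exact Submodule.add_mem _ h1 h2
  intro n
  rw [twist_apply]
  exact Submodule.sum_mem _ fun p _ => h1 _ _

theorem twist_compare (ξ : UU g) (B : Formal X →ₗ[ℂ] Formal Y →ₗ[ℂ] Formal Z)
    (B' : Formal X' →ₗ[ℂ] Formal Y' →ₗ[ℂ] Formal Z') (f : Z →ₗ[ℂ] Z') (Q : Submodule ℂ Z')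
    {x : Formal X} {y : Formal Y} {x' : Formal X'} {y' : Formal Y'}
    (h : ∀ a b, Formal.map f (B (formalAct ρ X a x) (formalAct ρ Y b y)) -
      B' (formalAct ρ' X' a x') (formalAct ρ' Y' b y') ∈ Formal.sub Q) :
    Formal.map f (twist ρ ξ B x y) - twist ρ' ξ B' x' y' ∈ Formal.sub Q := by
  have h1 : ∀ ζ, Formal.map f (twistTerm ρ B x y ζ) - twistTerm ρ' B' x' y' ζ ∈
      Formal.sub Q := by
    intro ζ
    induction ζ using TensorProduct.induction_on with
    | zero => simp
    | tmul a b => rw [twistTerm_tmul, twistTerm_tmul]; exact h a b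
    | add ζ ζ' h1 h2 =>
      rw [map_add, map_add, map_add, add_sub_add_comm]; exact Submodule.add_mem _ h1 h2
  intro n
  rw [Formal.sub_apply, Formal.map_apply, twist_apply, twist_apply, map_sum,
    ← Finset.sum_sub_distrib]
  exact Submodule.sum_mem _ fun p _ => h1 _ _

theorem formalAct_map (f : X →ₗ[ℂ] X') (h : ∀ t x, f ⁅ρ t, x⁆ = ⁅ρ' t, f x⁆) (a : Ug g)
    (x : Formal X) : Formal.map f (formalAct ρ X a x) = formalAct ρ' X' a (Formal.map f x) :=
  funext fun n => act_map ρ ρ' f h a (x n)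

theorem formalAct_mem (P : Submodule ℂ X) (h : ∀ v : VF A, ∀ x ∈ P, ⁅v, x⁆ ∈ P) (a : Ug g)
    {x : Formal X} (hx : x ∈ Formal.sub P) : formalAct ρ X a x ∈ Formal.sub P :=
  fun n => act_mem ρ P h a _ (hx n)

theorem mem_bot_iff {x : Formal X} : x ∈ Formal.sub (⊥ : Submodule ℂ X) ↔ x = 0 :=
  ⟨fun h => funext fun n => (Submodule.mem_bot ℂ).1 (h n), fun h n => by rw [h]; rfl⟩

/-- ⋆-products are natural with respect to equivariant maps. -/
theorem star_map (F : Twist g) (μ : X →ₗ[ℂ] Y →ₗ[ℂ] Z) (μ' : X' →ₗ[ℂ] Y' →ₗ[ℂ] Z')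
    (f₁ : X →ₗ[ℂ] X') (f₂ : Y →ₗ[ℂ] Y') (f : Z →ₗ[ℂ] Z')
    (h₁ : ∀ t x, f₁ ⁅ρ t, x⁆ = ⁅ρ' t, f₁ x⁆) (h₂ : ∀ t x, f₂ ⁅ρ t, x⁆ = ⁅ρ' t, f₂ x⁆)
    (h : ∀ x y, f (μ x y) = μ' (f₁ x) (f₂ y)) (x : Formal X) (y : Formal Y) :
    Formal.map f (starMap F ρ μ x y) = starMap F ρ' μ' (Formal.map f₁ x) (Formal.map f₂ y) := by
  have h3 : Formal.map f (starMap F ρ μ x y) - starMap F ρ' μ' (Formal.map f₁ x) (Formal.map f₂ y) ∈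
      Formal.sub (⊥ : Submodule ℂ Z') := by
    refine twist_compare ρ ρ' _ _ _ f ⊥ fun a b n => ?_
    rw [Submodule.mem_bot, Formal.sub_apply, sub_eq_zero, Formal.map_apply, Formal.bilin_apply,
      ← formalAct_map ρ ρ' f₁ h₁, ← formalAct_map ρ ρ' f₂ h₂, Formal.bilin_apply, map_sum]
    exact Finset.sum_congr rfl fun p _ => h _ _
  refine sub_eq_zero.1 (funext fun n => (Submodule.mem_bot ℂ).1 (h3 n))

theorem star_mem (F : Twist g) (μ : X →ₗ[ℂ] Y →ₗ[ℂ] Z) (P : Submodule ℂ X) (P' : Submodule ℂ Y)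
    (Q : Submodule ℂ Z) (hP : ∀ v : VF A, ∀ x ∈ P, ⁅v, x⁆ ∈ P)
    (hP' : ∀ v : VF A, ∀ y ∈ P', ⁅v, y⁆ ∈ P') (h : ∀ x y, x ∈ P ∨ y ∈ P' → μ x y ∈ Q)
    {x : Formal X} {y : Formal Y} (hxy : x ∈ Formal.sub P ∨ y ∈ Formal.sub P') :
    starMap F ρ μ x y ∈ Formal.sub Q :=
  twist_mem ρ _ _ Q fun a b => bilin_mem μ Q fun i j => h _ _
    (hxy.imp (fun h => formalAct_mem ρ P hP a h i) fun h => formalAct_mem ρ P' hP' b h j)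

theorem act_one (a : Ug g) : act ρ A a 1 = algebraMap ℂ A (counit g a) := by
  let S : Subalgebra ℂ (Ug g) :=
    { carrier := {a | act ρ A a 1 = algebraMap ℂ A (counit g a)}
      mul_mem' := fun {a b} ha hb => by
        change act ρ A (a * b) 1 = _
        change act ρ A a 1 = _ at ha
        change act ρ A b 1 = _ at hb
        rw [map_mul, Module.End.mul_apply, hb, Algebra.algebraMap_eq_smul_one, map_smul, ha,
          map_mul, mul_comm, map_mul, Algebra.smul_def]
      add_mem' := fun {a b} ha hb => by
        change act ρ A (a + b) 1 = _
        change act ρ A a 1 = _ at ha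
        change act ρ A b 1 = _ at hb
        rw [map_add, LinearMap.add_apply, ha, hb, map_add, map_add]
      algebraMap_mem' := fun c => by
        change act ρ A (algebraMap ℂ (Ug g) c) 1 = _
        rw [AlgHom.commutes, AlgHom.commutes, Module.algebraMap_end_apply,
          Algebra.algebraMap_eq_smul_one]
        rfl }
  exact U_induction S (fun t => by
    change act ρ A (UniversalEnvelopingAlgebra.ι ℂ t) 1 = _
    rw [act_ι]
    change ρ t 1 = _
    simp [counit]) a

theorem one_star (F : Twist g) (v : Formal (VF A)) :
    starMap F ρ smulVF (Formal.const 1) v = v := by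
  let φ : Ug g ⊗[ℂ] Ug g →ₐ[ℂ] Ug g := (Algebra.TensorProduct.lid ℂ (Ug g)).toAlgHom.comp
      (Algebra.TensorProduct.map (counit g) (AlgHom.id ℂ (Ug g)))
  have h1 : PowerSeries.map φ.toRingHom F.inv = 1 := by
    have h2 : PowerSeries.map φ.toRingHom (F.F : UU g) = 1 := F.counit_left
    have h3 : PowerSeries.map φ.toRingHom ((F.F : UU g) * F.inv) = 1 := by
      rw [Twist.inv, Units.mul_inv, map_one]
    rw [map_mul, h2, one_mul] at h3
    exact h3
  have h4 : ∀ ζ, twistTerm ρ (Formal.bilin smulVF) (Formal.const 1) v ζ =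
      formalAct ρ (VF A) (φ ζ) v := by
    intro ζ
    induction ζ using TensorProduct.induction_on with
    | zero => simp
    | add ζ ζ' h1 h2 => simp only [map_add, h1, h2, LinearMap.add_apply]
    | tmul a b =>
      rw [twistTerm_tmul]
      refine funext fun n => ?_
      rw [Formal.bilin_apply, Finset.sum_eq_single (0, n)]
      · change act ρ A a 1 • act ρ (VF A) b (v n) = act ρ (VF A) (φ (a ⊗ₜ b)) (v n)
        rw [act_one, algebraMap_smul]
        simp [φ]
      · rintro ⟨i, j⟩ hij hne
        have hi : i ≠ 0 := by
          rintro rfl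
          simp at hij
          exact hne (by rw [hij])
        change act ρ A a (Formal.const 1 i) • act ρ (VF A) b (v j) = 0
        rw [Formal.const, if_neg hi, map_zero, zero_smul]
      · simp
  refine funext fun n => ?_
  rw [starMap, twist_apply, Finset.sum_eq_single (0, n)]
  · have h5 := congrArg (PowerSeries.coeff 0) h1
    rw [PowerSeries.coeff_map, PowerSeries.coeff_one, if_pos rfl] at h5
    rw [h4]
    change formalAct ρ (VF A) (φ.toRingHom _) v n = _
    rw [h5]
    change act ρ (VF A) 1 (v n) = v n
    rw [map_one]; rfl
  · rintro ⟨i, j⟩ hij hne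
    have hi : i ≠ 0 := by
      rintro rfl
      simp at hij
      exact hne (by rw [hij])
    have h5 := congrArg (PowerSeries.coeff i) h1
    rw [PowerSeries.coeff_map, PowerSeries.coeff_one, if_neg hi] at h5
    rw [h4]
    change formalAct ρ (VF A) (φ.toRingHom _) v j = _
    rw [h5, map_zero]; rfl
  · simp

theorem smulVF_apply (f : A) (v : VF A) : smulVF f v = f • v := rfl

theorem applyVF_apply (v : VF A) (f : A) : applyVF v f = v f := rfl

theorem starVF_mem_aux (F : Twist g) (P : Submodule ℂ A) (P' Q : Submodule ℂ (VF A))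
    (hP : ∀ (v : VF A), ∀ f ∈ P, v f ∈ P) (hP' : ∀ (v : VF A), ∀ y ∈ P', ⁅v, y⁆ ∈ P')
    (h : ∀ (f : A) (y : VF A), f ∈ P ∨ y ∈ P' → f • y ∈ Q)
    {x : Formal A} {y : Formal (VF A)} (hxy : x ∈ Formal.sub P ∨ y ∈ Formal.sub P') :
    starMap F ρ smulVF x y ∈ Formal.sub Q := by
  have h1 : ∀ (v : VF A), ∀ f ∈ P, ⁅v, f⁆ ∈ P := fun v f hf => by
    rw [Derivation.bracket_eq_fun]; exact hP v f hf
  have h2 : ∀ (f : A) (y : VF A), f ∈ P ∨ y ∈ P' → smulVF f y ∈ Q := fun f y hf => by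
    rw [smulVF_apply]; exact h f y hf
  have h3 := star_mem ρ F smulVF P P' Q h1 hP' h2 (x := x) (y := y)
  exact h3 hxy

theorem starApply_mem_aux (F : Twist g) (P Q : Submodule ℂ A) (P' : Submodule ℂ (VF A))
    (hP : ∀ (v : VF A), ∀ f ∈ P, v f ∈ P) (hP' : ∀ (v : VF A), ∀ y ∈ P', ⁅v, y⁆ ∈ P')
    (h : ∀ (y : VF A) (f : A), y ∈ P' ∨ f ∈ P → y f ∈ Q)
    {x : Formal A} {y : Formal (VF A)} (hxy : y ∈ Formal.sub P' ∨ x ∈ Formal.sub P) :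
    starMap F ρ applyVF y x ∈ Formal.sub Q := by
  have h1 : ∀ (v : VF A), ∀ f ∈ P, ⁅v, f⁆ ∈ P := fun v f hf => by
    rw [Derivation.bracket_eq_fun]; exact hP v f hf
  have h2 : ∀ (y : VF A) (f : A), y ∈ P' ∨ f ∈ P → applyVF y f ∈ Q := fun f y hf => by
    rw [applyVF_apply]; exact h f y hf
  have h3 := star_mem ρ F applyVF P' P Q hP' h1 h2 (x := y) (y := x)
  exact h3 hxy

theorem formalAct_mem_fun (P : Submodule ℂ A) (hP : ∀ (v : VF A), ∀ f ∈ P, v f ∈ P) (a : Ug g)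
    {x : Formal A} (hx : x ∈ Formal.sub P) : formalAct ρ A a x ∈ Formal.sub P :=
  formalAct_mem ρ P (fun v f hf => by rw [Derivation.bracket_eq_fun]; exact hP v f hf) a hx

theorem formalAct_map_fun (f₁ : A →ₐ[ℂ] A') (h₁ : ∀ t x, f₁ (ρ t x) = ρ' t (f₁ x)) (a : Ug g)
    (x : Formal A) : Formal.map f₁.toLinearMap (formalAct ρ A a x) =
      formalAct ρ' A' a (Formal.map f₁.toLinearMap x) :=
  formalAct_map ρ ρ' f₁.toLinearMap
    (fun t x => by rw [Derivation.bracket_eq_fun, Derivation.bracket_eq_fun]; exact h₁ t x) a x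

theorem starVF_map (F : Twist g) (f₁ : A →ₐ[ℂ] A') (f₂ : VF A →ₗ[ℂ] VF A')
    (h₁ : ∀ t x, f₁ (ρ t x) = ρ' t (f₁ x)) (h₂ : ∀ t x, f₂ ⁅ρ t, x⁆ = ⁅ρ' t, f₂ x⁆)
    (h : ∀ f v, f₂ (f • v) = f₁ f • f₂ v) (x : Formal A) (y : Formal (VF A)) :
    Formal.map f₂ (starMap F ρ smulVF x y) =
      starMap F ρ' smulVF (Formal.map f₁.toLinearMap x) (Formal.map f₂ y) := by
  have h1 : ∀ t (x : A), f₁.toLinearMap ⁅ρ t, x⁆ = ⁅ρ' t, f₁.toLinearMap x⁆ := fun t x => by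
    rw [Derivation.bracket_eq_fun, Derivation.bracket_eq_fun]; exact h₁ t x
  have h2 : ∀ f v, f₂ (smulVF f v) = smulVF (f₁.toLinearMap f) (f₂ v) := fun f v => by
    rw [smulVF_apply, smulVF_apply]; exact h f v
  have h3 := star_map ρ ρ' F smulVF smulVF f₁.toLinearMap f₂ f₂ h1 h₂ h2 x y
  exact h3

theorem starApply_map (F : Twist g) (f₁ : A →ₐ[ℂ] A') (f₂ : VF A →ₗ[ℂ] VF A')
    (h₁ : ∀ t x, f₁ (ρ t x) = ρ' t (f₁ x)) (h₂ : ∀ t x, f₂ ⁅ρ t, x⁆ = ⁅ρ' t, f₂ x⁆)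
    (h : ∀ v f, f₁ (v f) = f₂ v (f₁ f)) (y : Formal (VF A)) (x : Formal A) :
    Formal.map f₁.toLinearMap (starMap F ρ applyVF y x) =
      starMap F ρ' applyVF (Formal.map f₂ y) (Formal.map f₁.toLinearMap x) := by
  have h1 : ∀ t (x : A), f₁.toLinearMap ⁅ρ t, x⁆ = ⁅ρ' t, f₁.toLinearMap x⁆ := fun t x => by
    rw [Derivation.bracket_eq_fun, Derivation.bracket_eq_fun]; exact h₁ t x
  have h2 : ∀ v f, f₁.toLinearMap (applyVF v f) = applyVF (f₂ v) (f₁.toLinearMap f) :=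
    fun v f => by rw [applyVF_apply, applyVF_apply]; exact h v f
  have h3 := star_map ρ ρ' F applyVF applyVF f₂ f₁.toLinearMap f₁.toLinearMap h₂ h1 h2 y x
  exact h3

/-- Locality of the last term of the Leibniz rule in its function argument. -/
theorem leibniz_mem (F : Twist g) (ξ : UU g) (B : Formal (VF A) →ₗ[ℂ] Formal (VF A))
    (P : Submodule ℂ A) (Q : Submodule ℂ (VF A)) (hP : ∀ (v : VF A), ∀ f ∈ P, v f ∈ P)
    (hQ : ∀ x ∈ Formal.sub P, ∀ y, starMap F ρ smulVF x y ∈ Formal.sub Q)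
    {x : Formal A} (hx : x ∈ Formal.sub P) (y : Formal (VF A)) :
    twist ρ ξ ((starMap F ρ smulVF).compl₂ B) x y ∈ Formal.sub Q :=
  twist_mem ρ ξ _ Q fun a b => by
    rw [LinearMap.compl₂_apply]
    exact hQ _ (formalAct_mem_fun ρ P hP a hx) _

/-- Comparison of the last terms of two Leibniz rules. -/
theorem leibniz_compare (F : Twist g) (ξ : UU g) (B : Formal (VF A) →ₗ[ℂ] Formal (VF A))
    (B' : Formal (VF A') →ₗ[ℂ] Formal (VF A')) (f : VF A →ₗ[ℂ] VF A')
    (Q : Submodule ℂ (VF A')) {x : Formal A} {y : Formal (VF A)} {x' : Formal A'}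
    {y' : Formal (VF A')}
    (h : ∀ a b, Formal.map f (starMap F ρ smulVF (formalAct ρ A a x) (B (formalAct ρ (VF A) b y))) -
      starMap F ρ' smulVF (formalAct ρ' A' a x') (B' (formalAct ρ' (VF A') b y')) ∈ Formal.sub Q) :
    Formal.map f (twist ρ ξ ((starMap F ρ smulVF).compl₂ B) x y) -
      twist ρ' ξ ((starMap F ρ' smulVF).compl₂ B') x' y' ∈ Formal.sub Q :=
  twist_compare ρ ρ' ξ _ _ f Q fun a b => by
    rw [LinearMap.compl₂_apply, LinearMap.compl₂_apply]
    exact h a b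

end Aux

/-! ## Complex-valued smooth functions and vector fields on a manifold -/

section Geometry

open scoped Manifold ContDiff Topology
open TopologicalSpace

variable (n : ℕ) (M : Type*) [TopologicalSpace M] [ChartedSpace (EuclideanSpace ℝ (Fin n)) M]

/-- The algebra `A = Fun(M)` of complex-valued smooth functions on `M`. -/
def smoothFun : Subalgebra ℂ (M → ℂ) where
  carrier := {f | ContMDiff (𝓡 n) 𝓘(ℝ, ℂ) ∞ f}
  mul_mem' hf hg := (contDiff_mul (𝕜 := ℝ) (𝔸 := ℂ)).contMDiff.comp (hf.prodMk_space hg)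
  add_mem' hf hg := hf.add hg
  algebraMap_mem' _ := contMDiff_const

/-- `Fun(M)` as a type. -/
def Fn : Type _ := smoothFun n M

instance : CommRing (Fn n M) := inferInstanceAs (CommRing (smoothFun n M))

instance : Algebra ℂ (Fn n M) := inferInstanceAs (Algebra ℂ (smoothFun n M))

variable {n M}

theorem Fn_ext {f f' : Fn n M} (h : ∀ p, f.1 p = f'.1 p) : f = f' :=
  Subtype.ext (funext h)

/-- Restriction of functions to an open subset `W`. -/
def restrictFun (n : ℕ) [ChartedSpace (EuclideanSpace ℝ (Fin n)) M] (W : Opens M) : Fn n M →ₐ[ℂ] Fn n W where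
  toFun f := ⟨fun p => f.1 p, ContMDiff.comp f.2 contMDiff_subtype_val⟩
  map_one' := rfl
  map_mul' _ _ := rfl
  map_zero' := rfl
  map_add' _ _ := rfl
  commutes' _ := rfl

theorem restrictFun_apply (W : Opens M) (f : Fn n M) (p : W) :
    (restrictFun n W f).1 p = f.1 p := rfl

theorem exists_bump [T2Space M] [IsManifold (𝓡 n) ∞ M] {V : Set M} {p : M} (hV : V ∈ 𝓝 p) :
    ∃ χ : Fn n M, tsupport χ.1 ⊆ V ∧ ∀ᶠ q in 𝓝 p, χ.1 q = 1 := by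
  obtain ⟨f, -, hf⟩ := (SmoothBumpFunction.nhds_basis_tsupport (I := 𝓡 n) p).mem_iff.1 hV
  have hs : ContMDiff (𝓡 n) 𝓘(ℝ, ℂ) ∞ (fun q => (f q : ℂ)) :=
    (Complex.ofRealCLM.contMDiff (n := ∞)).comp f.contMDiff
  refine ⟨⟨fun q => (f q : ℂ), hs⟩, ?_, ?_⟩
  · refine subset_trans (closure_mono ?_) hf
    intro q hq
    simp only [Function.mem_support, ne_eq, Complex.ofReal_eq_zero] at hq ⊢
    exact hq
  · filter_upwards [f.eventuallyEq_one] with q hq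
    simp [hq]

theorem exists_extend (W : Opens M) (χ : Fn n M) (hχ : tsupport χ.1 ⊆ W) :
    ∃ E : Fn n W →ₗ[ℂ] Fn n M,
      (∀ f (q : W), (E f).1 q = χ.1 q * f.1 q) ∧ ∀ f (q : M), q ∉ W → (E f).1 q = 0 := by
  classical
  refine ⟨{ toFun := fun f => ⟨fun q => if h : q ∈ W then χ.1 q * f.1 ⟨q, h⟩ else 0, ?_⟩
            map_add' := ?_
            map_smul' := ?_ }, ?_, ?_⟩
  · intro q
    by_cases hq : q ∈ W
    · have h2 : ContMDiffAt (𝓡 n) 𝓘(ℝ, ℂ) ∞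
          (fun x : W => if h : (x : M) ∈ W then χ.1 x * f.1 ⟨x, h⟩ else 0) ⟨q, hq⟩ := by
        have := ((restrictFun n W χ * f).2 : ContMDiff (𝓡 n) 𝓘(ℝ, ℂ) ∞ _) ⟨q, hq⟩
        refine this.congr_of_eventuallyEq (Filter.Eventually.of_forall fun x => ?_)
        simp only [x.2, dif_pos]
        rfl
      exact (contMDiffAt_subtype_iff (U := W) (x := ⟨q, hq⟩)
        (f := fun q => if h : q ∈ W then χ.1 q * f.1 ⟨q, h⟩ else 0)).1 h2
    · have hq' : (tsupport χ.1)ᶜ ∈ 𝓝 q :=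
        (isClosed_tsupport _).isOpen_compl.mem_nhds fun h => hq (hχ h)
      refine (contMDiffAt_const (c := (0 : ℂ))).congr_of_eventuallyEq ?_
      filter_upwards [hq'] with x hx
      simp [image_eq_zero_of_notMem_tsupport hx]
  · intro f f'
    refine Fn_ext fun q => ?_
    change (if h : q ∈ W then χ.1 q * (f.1 ⟨q, h⟩ + f'.1 ⟨q, h⟩) else 0) =
      (if h : q ∈ W then χ.1 q * f.1 ⟨q, h⟩ else 0) +
      (if h : q ∈ W then χ.1 q * f'.1 ⟨q, h⟩ else 0)
    split_ifs <;> ring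
  · intro c f
    refine Fn_ext fun q => ?_
    change (if h : q ∈ W then χ.1 q * (c * f.1 ⟨q, h⟩) else 0) =
      c * (if h : q ∈ W then χ.1 q * f.1 ⟨q, h⟩ else 0)
    split_ifs <;> ring
  · intro f q
    change (if h : (q : M) ∈ W then χ.1 q * f.1 ⟨q, h⟩ else 0) = _
    simp
  · intro f q hq
    change (if h : q ∈ W then χ.1 q * f.1 ⟨q, h⟩ else 0) = _
    simp [hq]

/-- Smooth functions vanishing on `V`. -/
def zeroFun (n : ℕ) [ChartedSpace (EuclideanSpace ℝ (Fin n)) M] (V : Set M) : Submodule ℂ (Fn n M) where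
  carrier := {f | ∀ q ∈ V, f.1 q = 0}
  add_mem' {f f'} hf hf' q hq := by
    change f.1 q + f'.1 q = 0
    rw [hf q hq, hf' q hq, add_zero]
  zero_mem' _ _ := rfl
  smul_mem' c f hf q hq := by
    change c * f.1 q = 0
    rw [hf q hq, mul_zero]

/-- Vector fields vanishing on `V`. -/
def zeroVF (n : ℕ) [ChartedSpace (EuclideanSpace ℝ (Fin n)) M] (V : Set M) : Submodule ℂ (VF (Fn n M)) where
  carrier := {X | ∀ f, X f ∈ zeroFun n V}
  add_mem' hX hY f := Submodule.add_mem _ (hX f) (hY f)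
  zero_mem' _ := Submodule.zero_mem _
  smul_mem' c _ hX f := Submodule.smul_mem _ c (hX f)

theorem mul_mem_zeroFun {V : Set M} {f f' : Fn n M} (h : f ∈ zeroFun n V ∨ f' ∈ zeroFun n V) :
    f * f' ∈ zeroFun n V := by
  intro q hq
  change f.1 q * f'.1 q = 0
  rcases h with h | h <;> simp [h q hq]

theorem smul_mem_zeroVF {V : Set M} {f : Fn n M} {X : VF (Fn n M)}
    (h : f ∈ zeroFun n V ∨ X ∈ zeroVF n V) : f • X ∈ zeroVF n V := fun f' =>
  mul_mem_zeroFun (h.imp id fun h => h f')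

/-- Gluing of vector fields. -/
theorem exists_glue (Y : M → VF (Fn n M))
    (h : ∀ p, ∃ V : Set M, IsOpen V ∧ p ∈ V ∧ ∀ q ∈ V, ∃ V' : Set M, q ∈ V' ∧
      Y q - Y p ∈ zeroVF n V') :
    ∃ X : VF (Fn n M), ∀ f p, (X f).1 p = (Y p f).1 p := by
  refine ⟨Derivation.mk' { toFun := fun f => ⟨fun p => (Y p f).1 p, ?_⟩
                           map_add' := ?_
                           map_smul' := ?_ } ?_, ?_⟩
  · intro p
    obtain ⟨V, hV, hpV, hY⟩ := h p
    refine ((Y p f).2 p).congr_of_eventuallyEq ?_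
    filter_upwards [hV.mem_nhds hpV] with q hq
    obtain ⟨V', hqV', h'⟩ := hY q hq
    exact sub_eq_zero.1 (h' f q hqV')
  · intro f f'
    refine Fn_ext fun p => ?_
    change (Y p (f + f')).1 p = (Y p f).1 p + (Y p f').1 p
    rw [map_add]; rfl
  · intro c f
    refine Fn_ext fun p => ?_
    change (Y p (c • f)).1 p = c * (Y p f).1 p
    rw [Derivation.map_smul]; rfl
  · intro f f'
    refine Fn_ext fun p => ?_
    change (Y p (f * f')).1 p = f.1 p * (Y p f').1 p + f'.1 p * (Y p f).1 p
    rw [Derivation.leibniz]; rfl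
  · intro f p
    rfl

theorem restrict_mem_zeroFun (W : Opens M) {V : Set W} {f : Fn n M}
    (h : restrictFun n W f ∈ zeroFun n V) : f ∈ zeroFun n (Subtype.val '' V) := by
  rintro _ ⟨q, hq, rfl⟩
  exact h q hq

theorem zeroVF_mono {V V' : Set M} (h : V ⊆ V') : zeroVF n V' ≤ zeroVF n V :=
  fun _ hX f q hq => hX f q (h hq)

theorem Formal_sub_zeroVF_mono {V V' : Set M} (h : V ⊆ V') :
    Formal.sub (zeroVF n V') ≤ Formal.sub (zeroVF n V) :=
  fun _ hX k => zeroVF_mono h (hX k)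

theorem mem_triangle {V V' V'' : Set M} {a b c : Formal (VF (Fn n M))}
    (h : V'' ⊆ V) (h' : V'' ⊆ V')
    (h1 : a - b ∈ Formal.sub (zeroVF n V)) (h2 : c - b ∈ Formal.sub (zeroVF n V')) :
    a - c ∈ Formal.sub (zeroVF n V'') := by
  rw [← sub_sub_sub_cancel_right a c b]
  exact Submodule.sub_mem _ (Formal_sub_zeroVF_mono h h1) (Formal_sub_zeroVF_mono h' h2)

theorem eq_zero_of_local {u : Formal (VF (Fn n M))}
    (h : ∀ p, ∃ V : Set M, p ∈ V ∧ u ∈ Formal.sub (zeroVF n V)) : u = 0 := by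
  refine funext fun k => ?_
  refine Derivation.ext fun f => Fn_ext fun p => ?_
  obtain ⟨V, hp, hu⟩ := h p
  exact hu k f p hp

theorem eq_of_local {a b : Formal (VF (Fn n M))} (h : ∀ p, ∃ V : Set M, p ∈ V ∧ ∃ c,
    c - a ∈ Formal.sub (zeroVF n V) ∧ c - b ∈ Formal.sub (zeroVF n V)) : a = b := by
  refine sub_eq_zero.1 (eq_zero_of_local fun p => ?_)
  obtain ⟨V, hp, c, h1, h2⟩ := h p
  refine ⟨V, hp, ?_⟩
  rw [← sub_sub_sub_cancel_left b a c]
  exact Submodule.sub_mem _ h2 h1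

section Local

variable [T2Space M] [IsManifold (𝓡 n) ∞ M]

theorem apply_mem_zeroFun {V : Set M} (hV : IsOpen V) {X : VF (Fn n M)}
    {f : Fn n M} (h : X ∈ zeroVF n V ∨ f ∈ zeroFun n V) : X f ∈ zeroFun n V := by
  rcases h with h | h
  · exact h f
  intro p hp
  obtain ⟨χ, hχ, hχ1⟩ := exists_bump (n := n) (hV.mem_nhds hp)
  have h0 : χ * f = 0 := Fn_ext fun q => by
    change χ.1 q * f.1 q = 0
    by_cases hq : q ∈ V
    · rw [h q hq, mul_zero]
    · rw [image_eq_zero_of_notMem_tsupport fun h' => hq (hχ h'), zero_mul]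
  have h1 := X.leibniz χ f
  rw [h0, map_zero] at h1
  have h2 := congrArg (fun a : Fn n M => a.1 p) h1
  change (0 : ℂ) = χ.1 p * (X f).1 p + f.1 p * (X χ).1 p at h2
  rw [h p hp, hχ1.self_of_nhds] at h2
  simpa using h2.symm

theorem lie_mem_zeroVF {V : Set M} (hV : IsOpen V) {X Y : VF (Fn n M)}
    (h : Y ∈ zeroVF n V) : ⁅X, Y⁆ ∈ zeroVF n V := fun f => by
  rw [Derivation.commutator_apply]
  exact Submodule.sub_mem _ (apply_mem_zeroFun hV (Or.inr (h f))) (h (X f))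

/-- Near any point of `W`, functions on `W` and vector fields on `W` agree with global ones. -/
theorem exists_local_extension (W : Opens M) (p : W) :
    ∃ V : Set W, IsOpen V ∧ p ∈ V ∧
      ∃ E : Fn n W →ₗ[ℂ] Fn n M,
      ∃ E' : VF (Fn n W) →ₗ[ℂ] VF (Fn n M),
        (∀ f, restrictFun n W (E f) - f ∈ zeroFun n V) ∧
        ∀ X f, ∀ q ∈ V, (E' X f).1 (q : M) = (X (restrictFun n W f)).1 q := by
  obtain ⟨χ, hχ, hχ1⟩ := exists_bump (n := n) (W.2.mem_nhds p.2)
  obtain ⟨E, hE, hE0⟩ := exists_extend W χ hχ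
  obtain ⟨V', hV', hV'o, hpV'⟩ := eventually_nhds_iff.1 hχ1
  refine ⟨Subtype.val ⁻¹' V', hV'o.preimage continuous_subtype_val, hpV', E, ?_⟩
  have key : ∀ (f : Fn n M) (a : Fn n W), E (restrictFun n W f * a) = f * E a := by
    intro f a
    refine Fn_ext fun q => ?_
    change _ = f.1 q * (E a).1 q
    by_cases hq : q ∈ W
    · have h1 := hE (restrictFun n W f * a) ⟨q, hq⟩
      have h2 := hE a ⟨q, hq⟩
      simp only at h1 h2
      rw [h1, h2]
      change χ.1 q * (f.1 q * a.1 ⟨q, hq⟩) = _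
      ring
    · rw [hE0 _ q hq, hE0 _ q hq, mul_zero]
  refine ⟨{ toFun := fun X => Derivation.mk' (E ∘ₗ (X : _ →ₗ[ℂ] _) ∘ₗ (restrictFun n W).toLinearMap)
              (fun a b => by
                change E (X (restrictFun n W (a * b))) = a * E (X (restrictFun n W b)) +
                  b * E (X (restrictFun n W a))
                rw [map_mul, Derivation.leibniz, map_add, smul_eq_mul, smul_eq_mul, key, key])
            map_add' := ?_
            map_smul' := ?_ }, ?_, ?_⟩
  · intro X Y
    ext1 f
    exact map_add E _ _
  · intro c X
    ext1 f
    exact map_smul E _ _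
  · intro f q hq
    change (E f).1 q - f.1 q = 0
    rw [hE, hV' _ hq, one_mul, sub_self]
  · intro X f q hq
    change (E (X (restrictFun n W f))).1 q = _
    rw [hE, hV' _ hq, one_mul]

/-- A vector field on `W` is determined by its action on restrictions of global functions. -/
theorem mem_zeroVF_of_restrict (W : Opens M) {V : Set W}
    {X : VF (Fn n W)} (h : ∀ f, X (restrictFun n W f) ∈ zeroFun n V) : X ∈ zeroVF n V := by
  intro f q hq
  obtain ⟨V', hV', hqV', E, -, hE, -⟩ := exists_local_extension (n := n) W q
  have h1 := apply_mem_zeroFun hV' (X := X) (Or.inr (hE f)) q hqV'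
  rw [map_sub] at h1
  change (X (restrictFun n W (E f))).1 q - (X f).1 q = 0 at h1
  rw [h _ q hq, zero_sub, neg_eq_zero] at h1
  exact h1

theorem exists_restrictVF (W : Opens M) (X : VF (Fn n M)) :
    ∃ Y : VF (Fn n W), ∀ f, Y (restrictFun n W f) = restrictFun n W (X f) := by
  choose V hV hpV E _ hE _ using exists_local_extension (n := n) W
  have key : ∀ (q : W) (V' : Set W) (F : Fn n M) (f : Fn n W), IsOpen V' → q ∈ V' →
      restrictFun n W F - f ∈ zeroFun n V' → (X F).1 q = (X (E q f)).1 q := by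
    intro q V' F f hV' hq h
    have h1 : F - E q f ∈ zeroFun n (Subtype.val '' (V' ∩ V q)) := by
      refine restrict_mem_zeroFun W fun x hx => ?_
      have h2 := h x hx.1
      have h3 := hE q f x hx.2
      change (restrictFun n W F).1 x - f.1 x = 0 at h2
      change (restrictFun n W (E q f)).1 x - f.1 x = 0 at h3
      change (restrictFun n W F).1 x - (restrictFun n W (E q f)).1 x = 0
      rw [sub_eq_zero] at *
      rw [h2, h3]
    have h2 := apply_mem_zeroFun (W.2.isOpenMap_subtype_val _ (hV'.inter (hV q)))
      (X := X) (Or.inr h1) q ⟨q, ⟨hq, hpV q⟩, rfl⟩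
    rw [map_sub] at h2
    exact sub_eq_zero.1 h2
  have key2 : ∀ (q : W) (F : Fn n M), (X F).1 q = (X (E q (restrictFun n W F))).1 q :=
    fun q F => key q Set.univ F _ isOpen_univ trivial (by rw [sub_self]; exact Submodule.zero_mem _)
  refine ⟨Derivation.mk' { toFun := fun f => ⟨fun p => (X (E p f)).1 p, ?_⟩
                           map_add' := ?_
                           map_smul' := ?_ } ?_, ?_⟩
  · intro p
    refine ((restrictFun n W (X (E p f))).2 p).congr_of_eventuallyEq ?_
    filter_upwards [(hV p).mem_nhds (hpV p)] with q hq
    exact (key q (V p) _ f (hV p) hq (hE p f)).symm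
  · intro f f'
    refine Fn_ext fun p => ?_
    change (X (E p (f + f'))).1 p = (X (E p f)).1 p + (X (E p f')).1 p
    rw [map_add, map_add]; rfl
  · intro c f
    refine Fn_ext fun p => ?_
    change (X (E p (c • f))).1 p = c * (X (E p f)).1 p
    rw [map_smul, Derivation.map_smul]; rfl
  · intro f f'
    refine Fn_ext fun p => ?_
    change (X (E p (f * f'))).1 p = f.1 p * (X (E p f')).1 p + f'.1 p * (X (E p f)).1 p
    have h1 : ∀ a : Fn n W, (E p a).1 p = a.1 p := fun a => sub_eq_zero.1 (hE p a p (hpV p))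
    rw [← key p (V p) (E p f * E p f') (f * f') (hV p) (hpV p), Derivation.leibniz]
    · change (E p f).1 p * (X (E p f')).1 p + (E p f').1 p * (X (E p f)).1 p = _
      rw [h1, h1]
    · intro q hq
      have h2 : ∀ a : Fn n W, (E p a).1 q = a.1 q := fun a => sub_eq_zero.1 (hE p a q hq)
      change (E p f).1 q * (E p f').1 q - f.1 q * f'.1 q = 0
      rw [h2, h2, sub_self]
  · intro f
    exact Fn_ext fun p => (key2 p f).symm

theorem VF_ext (W : Opens M) {X Y : VF (Fn n W)}
    (h : ∀ f, X (restrictFun n W f) = Y (restrictFun n W f)) : X = Y := by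
  have h1 : X - Y ∈ zeroVF n (Set.univ : Set W) := mem_zeroVF_of_restrict W fun f => by
    rw [Derivation.sub_apply, h, sub_self]; exact Submodule.zero_mem _
  refine Derivation.ext fun f => Fn_ext fun p => ?_
  exact sub_eq_zero.1 (h1 f p trivial)

/-- Restriction of vector fields to an open subset `W`, characterized by
`X|_W (f|_W) = (X f)|_W`. -/
def restrictVF (n : ℕ) [ChartedSpace (EuclideanSpace ℝ (Fin n)) M]
    [IsManifold (𝓡 n) ∞ M] (W : Opens M) : VF (Fn n M) →ₗ⁅ℂ⁆ VF (Fn n W) :=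
  have h := fun X => (exists_restrictVF W X).choose_spec
  { toFun := fun X => (exists_restrictVF W X).choose
    map_add' := fun X Y => VF_ext W fun f => by
      rw [h, Derivation.add_apply, Derivation.add_apply, h, h, map_add]
    map_smul' := fun c X => VF_ext W fun f => by
      rw [h, Derivation.smul_apply, RingHom.id_apply, Derivation.smul_apply, h, map_smul]
    map_lie' := fun {X Y} => VF_ext W fun f => by
      rw [h, Derivation.commutator_apply, Derivation.commutator_apply, h, h, h, h, map_sub] }

theorem restrictVF_apply (W : Opens M) (X : VF (Fn n M)) (f : Fn n M) :
    restrictVF n W X (restrictFun n W f) = restrictFun n W (X f) :=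
  (exists_restrictVF W X).choose_spec f


/-! ## Restriction of a ⋆-covariant derivative to an open subset -/

theorem lie_mem_zeroFun {V : Set M} (hV : IsOpen V) (X : VF (Fn n M)) :
    ∀ f ∈ zeroFun n V, X f ∈ zeroFun n V := fun _ hf =>
  apply_mem_zeroFun hV (X := X) (Or.inr hf)

variable {g : Type*} [LieRing g] [LieAlgebra ℂ g] {F : Twist g} {ρ : g →ₗ⁅ℂ⁆ VF (Fn n M)}

theorem starVF_mem {V : Set M} (hV : IsOpen V) {h : Formal (Fn n M)}
    {u : Formal (VF (Fn n M))}
    (hu : h ∈ Formal.sub (zeroFun n V) ∨ u ∈ Formal.sub (zeroVF n V)) :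
    starMap F ρ (smulVF (A := Fn n M)) h u ∈ Formal.sub (zeroVF n V) :=
  starVF_mem_aux ρ F (zeroFun n V) (zeroVF n V) (zeroVF n V) (lie_mem_zeroFun hV)
    (fun _ _ => lie_mem_zeroVF hV) (fun _ _ => smul_mem_zeroVF) hu

theorem starVF_congr {V : Set M} (hV : IsOpen V) {h h' : Formal (Fn n M)}
    {u u' : Formal (VF (Fn n M))} (hh : h - h' ∈ Formal.sub (zeroFun n V))
    (hu : u - u' ∈ Formal.sub (zeroVF n V)) :
    starMap F ρ (smulVF (A := Fn n M)) h u - starMap F ρ (smulVF (A := Fn n M)) h' u' ∈ Formal.sub (zeroVF n V) := by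
  have h1 : starMap F ρ (smulVF (A := Fn n M)) h u - starMap F ρ (smulVF (A := Fn n M)) h' u' =
      starMap F ρ (smulVF (A := Fn n M)) (h - h') u + starMap F ρ (smulVF (A := Fn n M)) h' (u - u') := by
    simp only [map_sub, LinearMap.sub_apply]; abel
  rw [h1]
  exact Submodule.add_mem _ (starVF_mem hV (Or.inl hh)) (starVF_mem hV (Or.inr hu))

theorem starApply_mem {V : Set M} (hV : IsOpen V) {u : Formal (VF (Fn n M))}
    {h : Formal (Fn n M)}
    (hu : u ∈ Formal.sub (zeroVF n V) ∨ h ∈ Formal.sub (zeroFun n V)) :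
    starMap F ρ (applyVF (A := Fn n M)) u h ∈ Formal.sub (zeroFun n V) :=
  starApply_mem_aux ρ F (zeroFun n V) (zeroFun n V) (zeroVF n V) (lie_mem_zeroFun hV)
    (fun _ _ => lie_mem_zeroVF hV) (fun _ _ => apply_mem_zeroFun hV) hu

theorem starApply_congr {V : Set M} (hV : IsOpen V) {u u' : Formal (VF (Fn n M))}
    {h h' : Formal (Fn n M)} (hu : u - u' ∈ Formal.sub (zeroVF n V))
    (hh : h - h' ∈ Formal.sub (zeroFun n V)) :
    starMap F ρ (applyVF (A := Fn n M)) u h - starMap F ρ (applyVF (A := Fn n M)) u' h' ∈ Formal.sub (zeroFun n V) := by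
  have h1 : starMap F ρ (applyVF (A := Fn n M)) u h - starMap F ρ (applyVF (A := Fn n M)) u' h' =
      starMap F ρ (applyVF (A := Fn n M)) (u - u') h + starMap F ρ (applyVF (A := Fn n M)) u' (h - h') := by
    simp only [map_sub, LinearMap.sub_apply]; abel
  rw [h1]
  exact Submodule.add_mem _ (starApply_mem hV (Or.inl hu)) (starApply_mem hV (Or.inr hh))

theorem exists_cutoff {V : Set M} (hV : IsOpen V) {u : Formal (VF (Fn n M))}
    (hu : u ∈ Formal.sub (zeroVF n V)) {p : M} (hp : p ∈ V) :
    ∃ h : Formal (Fn n M), ∃ V' : Set M, IsOpen V' ∧ p ∈ V' ∧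
      h ∈ Formal.sub (zeroFun n V') ∧ starMap F ρ (smulVF (A := Fn n M)) h u = u := by
  obtain ⟨χ, hχ, hχ1⟩ := exists_bump (n := n) (hV.mem_nhds hp)
  obtain ⟨V', hV', hV'o, hpV'⟩ := eventually_nhds_iff.1 hχ1
  refine ⟨Formal.const 1 - Formal.const χ, V', hV'o, hpV', ?_, ?_⟩
  · intro k q hq
    rw [Formal.sub_apply, Formal.const, Formal.const]
    split_ifs
    · change 1 - χ.1 q = 0
      rw [hV' q hq, sub_self]
    · rw [sub_zero]; rfl
  · have h0 : starMap F ρ (smulVF (A := Fn n M)) (Formal.const χ) u = 0 := by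
      refine eq_zero_of_local fun q => ?_
      by_cases hq : q ∈ V
      · exact ⟨V, hq, starVF_mem hV (Or.inr hu)⟩
      · refine ⟨(tsupport χ.1)ᶜ, fun h => hq (hχ h),
          starVF_mem (isClosed_tsupport _).isOpen_compl (Or.inl fun k x hx => ?_)⟩
        rw [Formal.const]
        split_ifs
        · exact image_eq_zero_of_notMem_tsupport hx
        · rfl
    rw [map_sub, LinearMap.sub_apply, h0, sub_zero, one_star]

theorem nabla_mem (D : StarConnection F ρ) {V : Set M} (hV : IsOpen V)
    {u v : Formal (VF (Fn n M))}
    (h : u ∈ Formal.sub (zeroVF n V) ∨ v ∈ Formal.sub (zeroVF n V)) :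
    D.nabla u v ∈ Formal.sub (zeroVF n V) := by
  intro k f p hp
  rcases h with h | h
  · obtain ⟨c, V', hV', hpV', hc, hcu⟩ := exists_cutoff (F := F) (ρ := ρ) hV h hp
    rw [← hcu, D.smul_left]
    exact starVF_mem hV' (Or.inl hc) k f p hpV'
  · obtain ⟨c, V', hV', hpV', hc, hcu⟩ := exists_cutoff (F := F) (ρ := ρ) hV h hp
    rw [← hcu, D.leibniz]
    refine Submodule.add_mem (Formal.sub (zeroVF n V'))
      (starVF_mem hV' (Or.inl (starApply_mem hV' (Or.inr hc)))) ?_ k f p hpV'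
    exact leibniz_mem ρ F F.Rinv (D.nabla.flip v) (zeroFun n V') (zeroVF n V')
      (lie_mem_zeroFun hV') (fun x hx y => starVF_mem hV' (Or.inl hx)) hc u

theorem nabla_congr (D : StarConnection F ρ) {V : Set M} (hV : IsOpen V)
    {u v u' v' : Formal (VF (Fn n M))} (hu : u - u' ∈ Formal.sub (zeroVF n V))
    (hv : v - v' ∈ Formal.sub (zeroVF n V)) :
    D.nabla u v - D.nabla u' v' ∈ Formal.sub (zeroVF n V) := by
  have h1 : D.nabla u v - D.nabla u' v' = D.nabla (u - u') v + D.nabla u' (v - v') := by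
    simp only [map_sub, LinearMap.sub_apply]; abel
  rw [h1]
  exact Submodule.add_mem _ (nabla_mem D hV (Or.inl hu)) (nabla_mem D hV (Or.inr hv))

/-- Coefficientwise restriction of formal vector fields to an open subset. -/
def restrictFormalVF (n : ℕ) [ChartedSpace (EuclideanSpace ℝ (Fin n)) M]
    [IsManifold (𝓡 n) ∞ M] (W : Opens M) :
    Formal (VF (Fn n M)) →ₗ[ℂ] Formal (VF (Fn n W)) :=
  Formal.map (restrictVF n W : VF (Fn n M) →ₗ[ℂ] VF (Fn n W))

theorem restrictFormalVF_mem_iff (W : Opens M) {V : Set W} {u : Formal (VF (Fn n M))} :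
    restrictFormalVF n W u ∈ Formal.sub (zeroVF n V) ↔
      u ∈ Formal.sub (zeroVF n (Subtype.val '' V)) := by
  constructor
  · rintro h k f _ ⟨q, hq, rfl⟩
    have h1 := h k (restrictFun n W f) q hq
    change (restrictVF n W (u k) (restrictFun n W f)).1 q = 0 at h1
    rw [restrictVF_apply] at h1
    exact h1
  · intro h k
    refine mem_zeroVF_of_restrict W fun f q hq => ?_
    change (restrictVF n W (u k) (restrictFun n W f)).1 q = 0
    rw [restrictVF_apply]
    exact h k f q ⟨q, hq, rfl⟩

theorem restrict_nabla_congr (D : StarConnection F ρ) (W : Opens M) {V : Set W} (hV : IsOpen V)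
    {x y x' y' : Formal (VF (Fn n M))}
    (hx : restrictFormalVF n W x - restrictFormalVF n W x' ∈ Formal.sub (zeroVF n V))
    (hy : restrictFormalVF n W y - restrictFormalVF n W y' ∈ Formal.sub (zeroVF n V)) :
    restrictFormalVF n W (D.nabla x y) - restrictFormalVF n W (D.nabla x' y') ∈
      Formal.sub (zeroVF n V) := by
  rw [← map_sub, restrictFormalVF_mem_iff] at *
  exact nabla_congr D (W.2.isOpenMap_subtype_val _ hV) hx hy

/-- The operation on vector fields over `W` induced by a ⋆-covariant derivative on `M`. -/
theorem exists_local_nabla (D : StarConnection F ρ) (W : Opens M) :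
    ∃ N : Formal (VF (Fn n W)) → Formal (VF (Fn n W)) →
        Formal (VF (Fn n W)),
      ∀ (V : Set W) x y u v, IsOpen V →
        restrictFormalVF n W x - u ∈ Formal.sub (zeroVF n V) →
        restrictFormalVF n W y - v ∈ Formal.sub (zeroVF n V) →
        restrictFormalVF n W (D.nabla x y) - N u v ∈ Formal.sub (zeroVF n V) := by
  choose V hV hpV _ E _ hE using exists_local_extension (n := n) W
  have hE' : ∀ p u, restrictFormalVF n W (Formal.map (E p) u) - u ∈ Formal.sub (zeroVF n (V p)) := by
    intro p u k
    refine mem_zeroVF_of_restrict W fun f q hq => ?_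
    change (restrictVF n W (E p (u k)) (restrictFun n W f)).1 q - (u k (restrictFun n W f)).1 q = 0
    rw [restrictVF_apply, sub_eq_zero]
    exact hE p (u k) f q hq
  let Y : W → Formal (VF (Fn n W)) → Formal (VF (Fn n W)) →
      Formal (VF (Fn n W)) := fun p u v =>
    restrictFormalVF n W (D.nabla (Formal.map (E p) u) (Formal.map (E p) v))
  have hY : ∀ (p : W) (V' : Set W) x y u v, IsOpen V' →
      restrictFormalVF n W x - u ∈ Formal.sub (zeroVF n V') →
      restrictFormalVF n W y - v ∈ Formal.sub (zeroVF n V') →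
      restrictFormalVF n W (D.nabla x y) - Y p u v ∈ Formal.sub (zeroVF n (V' ∩ V p)) := by
    intro p V' x y u v hV' hx hy
    exact restrict_nabla_congr D W (hV'.inter (hV p))
      (mem_triangle Set.inter_subset_left Set.inter_subset_right hx (hE' p u))
      (mem_triangle Set.inter_subset_left Set.inter_subset_right hy (hE' p v))
  have glue : ∀ u v k, ∃ X : VF (Fn n W), ∀ f p, (X f).1 p = (Y p u v k f).1 p := by
    intro u v k
    refine exists_glue (fun p => Y p u v k) fun p => ⟨V p, hV p, hpV p, fun q hq => ?_⟩
    exact ⟨V q ∩ V p, ⟨hpV q, hq⟩, hY p (V q) _ _ u v (hV q) (hE' q u) (hE' q v) k⟩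
  choose N hN using glue
  refine ⟨fun u v k => N u v k, fun V' x y u v hV' hx hy k f q hq => ?_⟩
  have h1 := hY q V' x y u v hV' hx hy k f q ⟨hq, hpV q⟩
  change (restrictFormalVF n W (D.nabla x y) k f).1 q - (Y q u v k f).1 q = 0 at h1
  change (restrictFormalVF n W (D.nabla x y) k f).1 q - (N u v k f).1 q = 0
  rw [hN, h1]

theorem restrictVF_lie (W : Opens M) (t : g) (X : VF (Fn n M)) :
    (restrictVF n W : VF (Fn n M) →ₗ[ℂ] VF (Fn n W)) ⁅ρ t, X⁆ =
      ⁅(restrictVF n W).comp ρ t, (restrictVF n W : _ →ₗ[ℂ] VF (Fn n W)) X⁆ :=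
  LieHom.map_lie (restrictVF n W) (ρ t) X

theorem restrict_starVF (W : Opens M) (h : Formal (Fn n M)) (u : Formal (VF (Fn n M))) :
    restrictFormalVF n W (starMap F ρ smulVF h u) = starMap F ((restrictVF n W).comp ρ) smulVF
      (Formal.map (restrictFun n W).toLinearMap h) (restrictFormalVF n W u) := by
  refine starVF_map ρ ((restrictVF n W).comp ρ) F (restrictFun n W) _
    (fun t f => (restrictVF_apply W (ρ t) f).symm) (restrictVF_lie W) (fun f X => ?_) h u
  refine VF_ext W fun f' => ?_
  change restrictVF n W (f • X) (restrictFun n W f') =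
    restrictFun n W f * restrictVF n W X (restrictFun n W f')
  rw [restrictVF_apply, restrictVF_apply, Derivation.smul_apply, smul_eq_mul, map_mul]

theorem restrict_starApply (W : Opens M) (u : Formal (VF (Fn n M))) (h : Formal (Fn n M)) :
    Formal.map (restrictFun n W).toLinearMap (starMap F ρ applyVF u h) =
      starMap F ((restrictVF n W).comp ρ) applyVF (restrictFormalVF n W u)
        (Formal.map (restrictFun n W).toLinearMap h) :=
  starApply_map ρ ((restrictVF n W).comp ρ) F (restrictFun n W) _
    (fun t f => (restrictVF_apply W (ρ t) f).symm) (restrictVF_lie W)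
    (fun X f => (restrictVF_apply W X f).symm) u h

theorem exists_chart_extension (W : Opens M) (p : W) :
    ∃ V : Set W, IsOpen V ∧ p ∈ V ∧
      (∀ h : Formal (Fn n W), ∃ h' : Formal (Fn n M),
        Formal.map (restrictFun n W).toLinearMap h' - h ∈ Formal.sub (zeroFun n V)) ∧
      ∀ u : Formal (VF (Fn n W)), ∃ u' : Formal (VF (Fn n M)),
        restrictFormalVF n W u' - u ∈ Formal.sub (zeroVF n V) := by
  obtain ⟨V, hV, hpV, E₀, E, hE₀, hE⟩ := exists_local_extension (n := n) W p
  refine ⟨V, hV, hpV, fun h => ⟨Formal.map E₀ h, fun k => hE₀ (h k)⟩,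
    fun u => ⟨Formal.map E u, fun k => ?_⟩⟩
  refine mem_zeroVF_of_restrict W fun f q hq => ?_
  change (restrictVF n W (E (u k)) (restrictFun n W f)).1 q - (u k (restrictFun n W f)).1 q = 0
  rw [restrictVF_apply, sub_eq_zero]
  exact hE (u k) f q hq

/-- `N` is, near each point of `W`, given by `D` applied to global fields. -/
def IsLocalNabla (D : StarConnection F ρ) (W : Opens M)
    (N : Formal (VF (Fn n W)) → Formal (VF (Fn n W)) → Formal (VF (Fn n W))) : Prop :=
  ∀ (V : Set W) x y u v, IsOpen V →
    restrictFormalVF n W x - u ∈ Formal.sub (zeroVF n V) →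
    restrictFormalVF n W y - v ∈ Formal.sub (zeroVF n V) →
    restrictFormalVF n W (D.nabla x y) - N u v ∈ Formal.sub (zeroVF n V)

theorem exists_bilinear_nabla (D : StarConnection F ρ) (W : Opens M) :
    ∃ N : Formal (VF (Fn n W)) →ₗ[ℂ] Formal (VF (Fn n W)) →ₗ[ℂ] Formal (VF (Fn n W)),
      IsLocalNabla D W fun u v => N u v := by
  obtain ⟨N, hN⟩ := exists_local_nabla D W
  choose V hV hpV _ hE using exists_chart_extension (n := n) W
  choose E hE using hE
  refine ⟨LinearMap.mk₂ ℂ N ?_ ?_ ?_ ?_, hN⟩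
  · intro u u' v
    refine eq_of_local fun p => ⟨V p, hpV p, restrictFormalVF n W (D.nabla (E p u + E p u')
      (E p v)), hN _ _ _ _ _ (hV p) ?_ (hE p _), ?_⟩
    · rw [map_add, add_sub_add_comm]
      exact Submodule.add_mem _ (hE p _) (hE p _)
    · rw [map_add, LinearMap.add_apply, map_add, add_sub_add_comm]
      exact Submodule.add_mem _ (hN _ _ _ _ _ (hV p) (hE p _) (hE p _))
        (hN _ _ _ _ _ (hV p) (hE p _) (hE p _))
  · intro c u v
    refine eq_of_local fun p => ⟨V p, hpV p, restrictFormalVF n W (D.nabla (c • E p u)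
      (E p v)), hN _ _ _ _ _ (hV p) ?_ (hE p _), ?_⟩
    · rw [map_smul, ← smul_sub]
      exact Submodule.smul_mem _ c (hE p _)
    · rw [map_smul, LinearMap.smul_apply, map_smul, ← smul_sub]
      exact Submodule.smul_mem _ c (hN _ _ _ _ _ (hV p) (hE p _) (hE p _))
  · intro u v v'
    refine eq_of_local fun p => ⟨V p, hpV p, restrictFormalVF n W (D.nabla (E p u)
      (E p v + E p v')), hN _ _ _ _ _ (hV p) (hE p _) ?_, ?_⟩
    · rw [map_add, add_sub_add_comm]
      exact Submodule.add_mem _ (hE p _) (hE p _)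
    · rw [map_add, map_add, add_sub_add_comm]
      exact Submodule.add_mem _ (hN _ _ _ _ _ (hV p) (hE p _) (hE p _))
        (hN _ _ _ _ _ (hV p) (hE p _) (hE p _))
  · intro c u v
    refine eq_of_local fun p => ⟨V p, hpV p, restrictFormalVF n W (D.nabla (E p u)
      (c • E p v)), hN _ _ _ _ _ (hV p) (hE p _) ?_, ?_⟩
    · rw [map_smul, ← smul_sub]
      exact Submodule.smul_mem _ c (hE p _)
    · rw [map_smul, map_smul, ← smul_sub]
      exact Submodule.smul_mem _ c (hN _ _ _ _ _ (hV p) (hE p _) (hE p _))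

theorem local_smul_left (D : StarConnection F ρ) (W : Opens M)
    (N : Formal (VF (Fn n W)) →ₗ[ℂ] Formal (VF (Fn n W)) →ₗ[ℂ] Formal (VF (Fn n W)))
    (hN : IsLocalNabla D W fun u v => N u v) (h : Formal (Fn n W)) (u v : Formal (VF (Fn n W))) :
    N (starMap F ((restrictVF n W).comp ρ) smulVF h u) v =
      starMap F ((restrictVF n W).comp ρ) smulVF h (N u v) := by
  refine eq_of_local fun p => ?_
  obtain ⟨V, hV, hpV, hE₀, hE⟩ := exists_chart_extension (n := n) W p
  obtain ⟨h', hh⟩ := hE₀ h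
  obtain ⟨x, hx⟩ := hE u
  obtain ⟨y, hy⟩ := hE v
  refine ⟨V, hpV, restrictFormalVF n W (D.nabla (starMap F ρ smulVF h' x) y), ?_, ?_⟩
  · refine hN _ _ _ _ _ hV ?_ hy
    rw [restrict_starVF]
    exact starVF_congr hV hh hx
  · rw [D.smul_left, restrict_starVF]
    exact starVF_congr hV hh (hN _ _ _ _ _ hV hx hy)

theorem local_leibniz_aux (D : StarConnection F ρ) (W : Opens M)
    (N : Formal (VF (Fn n W)) →ₗ[ℂ] Formal (VF (Fn n W)) →ₗ[ℂ] Formal (VF (Fn n W)))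
    (hN : IsLocalNabla D W fun u v => N u v) {V : Set W} (hV : IsOpen V)
    {h' : Formal (Fn n M)} {h : Formal (Fn n W)} {x y : Formal (VF (Fn n M))}
    {u v : Formal (VF (Fn n W))}
    (hh : Formal.map (restrictFun n W).toLinearMap h' - h ∈ Formal.sub (zeroFun n V))
    (hx : restrictFormalVF n W x - u ∈ Formal.sub (zeroVF n V))
    (hy : restrictFormalVF n W y - v ∈ Formal.sub (zeroVF n V)) (a b : Ug g) :
    restrictFormalVF n W (starMap F ρ smulVF (formalAct ρ (Fn n M) a h')
        (D.nabla (formalAct ρ (VF (Fn n M)) b x) y)) -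
      starMap F ((restrictVF n W).comp ρ) smulVF
        (formalAct ((restrictVF n W).comp ρ) (Fn n W) a h)
        (N (formalAct ((restrictVF n W).comp ρ) (VF (Fn n W)) b u) v) ∈
      Formal.sub (zeroVF n V) := by
  have h1 : Formal.map (restrictFun n W).toLinearMap (formalAct ρ (Fn n M) a h') =
      formalAct ((restrictVF n W).comp ρ) (Fn n W) a
        (Formal.map (restrictFun n W).toLinearMap h') :=
    formalAct_map_fun ρ ((restrictVF n W).comp ρ) (restrictFun n W)
        (fun t f => (restrictVF_apply W (ρ t) f).symm) a h'
  have h2 : restrictFormalVF n W (formalAct ρ (VF (Fn n M)) b x) =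
      formalAct ((restrictVF n W).comp ρ) (VF (Fn n W)) b (restrictFormalVF n W x) :=
    formalAct_map ρ ((restrictVF n W).comp ρ) _ (restrictVF_lie W) b x
  have h3 : Formal.map (restrictFun n W).toLinearMap (formalAct ρ (Fn n M) a h') -
      formalAct ((restrictVF n W).comp ρ) (Fn n W) a h ∈ Formal.sub (zeroFun n V) := by
    rw [h1, ← map_sub]
    exact formalAct_mem_fun _ _ (lie_mem_zeroFun hV) a hh
  have h4 : restrictFormalVF n W (formalAct ρ (VF (Fn n M)) b x) -
      formalAct ((restrictVF n W).comp ρ) (VF (Fn n W)) b u ∈ Formal.sub (zeroVF n V) := by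
    rw [h2, ← map_sub]
    exact formalAct_mem _ _ (fun _ _ => lie_mem_zeroVF hV) b hx
  rw [restrict_starVF]
  exact starVF_congr hV h3 (hN _ _ _ _ _ hV h4 hy)

theorem local_leibniz (D : StarConnection F ρ) (W : Opens M)
    (N : Formal (VF (Fn n W)) →ₗ[ℂ] Formal (VF (Fn n W)) →ₗ[ℂ] Formal (VF (Fn n W)))
    (hN : IsLocalNabla D W fun u v => N u v) (u : Formal (VF (Fn n W))) (h : Formal (Fn n W))
    (v : Formal (VF (Fn n W))) :
    N u (starMap F ((restrictVF n W).comp ρ) smulVF h v) =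
      starMap F ((restrictVF n W).comp ρ) smulVF
        (starMap F ((restrictVF n W).comp ρ) applyVF u h) v +
      twist ((restrictVF n W).comp ρ) F.Rinv
        ((starMap F ((restrictVF n W).comp ρ) smulVF).compl₂ (N.flip v)) h u := by
  refine eq_of_local fun p => ?_
  obtain ⟨V, hV, hpV, hE₀, hE⟩ := exists_chart_extension (n := n) W p
  obtain ⟨h', hh⟩ := hE₀ h
  obtain ⟨x, hx⟩ := hE u
  obtain ⟨y, hy⟩ := hE v
  refine ⟨V, hpV, restrictFormalVF n W (D.nabla x (starMap F ρ smulVF h' y)), ?_, ?_⟩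
  · refine hN _ _ _ _ _ hV hx ?_
    rw [restrict_starVF]
    exact starVF_congr hV hh hy
  · rw [D.leibniz, map_add, add_sub_add_comm, restrict_starVF, restrict_starApply]
    refine Submodule.add_mem _ (starVF_congr hV (starApply_congr hV hx hh) hy) ?_
    have h1 := leibniz_compare ρ ((restrictVF n W).comp ρ) F F.Rinv (D.nabla.flip y) (N.flip v)
      (restrictVF n W : VF (Fn n M) →ₗ[ℂ] VF (Fn n W)) (zeroVF n V)
      (local_leibniz_aux D W N hN hV hh hx hy)
    exact h1

/-- A ⋆-covariant derivative on `M` restricts to a ⋆-covariant derivative on each open subset. -/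
theorem exists_restrict (D : StarConnection F ρ) (W : Opens M) :
    ∃ D' : StarConnection F ((restrictVF n W).comp ρ), ∀ u v,
      D'.nabla (restrictFormalVF n W u) (restrictFormalVF n W v) =
        restrictFormalVF n W (D.nabla u v) := by
  obtain ⟨N, hN⟩ := exists_bilinear_nabla D W
  refine ⟨⟨N, local_smul_left D W N hN, local_leibniz D W N hN⟩, fun u v => ?_⟩
  refine eq_of_local fun p => ⟨Set.univ, trivial, restrictFormalVF n W (D.nabla u v), ?_, ?_⟩
  · refine hN _ _ _ _ _ isOpen_univ ?_ ?_ <;>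
    · rw [sub_self]; exact Submodule.zero_mem _
  · rw [sub_self]; exact Submodule.zero_mem _

/-- The restriction of a ⋆-covariant derivative to an open subset `W`, characterized by
`(∇|_W)_{u|_W} (v|_W) = (∇_u v)|_W`. -/
def StarConnection.restrict (D : StarConnection F ρ) (W : Opens M) :
    StarConnection F ((restrictVF n W).comp ρ) :=
  (exists_restrict D W).choose

theorem StarConnection.restrict_nabla (D : StarConnection F ρ) (W : Opens M)
    (u v : Formal (VF (Fn n M))) :
    (D.restrict W).nabla (restrictFormalVF n W u) (restrictFormalVF n W v) =
      restrictFormalVF n W (D.nabla u v) :=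
  (exists_restrict D W).choose_spec u v

end Local
end Geometry

end StarGeometry

end

open StarGeometry TopologicalSpace
open scoped Manifold ContDiff

/-!
The structural equations are compared with torsion and curvature by evaluating 2-forms on vector
fields in the ⋆-sense, and the comparison is reduced to one identity, `evalBi_extD_sub`. It holds
over any commutative `ℂ`-algebra `A`; the manifold enters only through `A` and the restriction
of `ρ` and `∇` to `W`.

*Deforming classical identities.* Every ⋆-operation is a classical bilinear map composed with the
action of `𝓕⁻¹`. If the inner map of an iterated operation is equivariant, the operation is a
classical trilinear map composed with the action of `(id ⊗ Δ)(𝓕⁻¹) 𝓕⁻¹₂₃`, or of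
`(Δ ⊗ id)(𝓕⁻¹) 𝓕⁻¹₁₂`, according to the bracketing; the cocycle condition says that the two
agree. So every linear relation between equivariant trilinear expressions survives deformation
(`starMap_starMap_right`, `starMap_starMap_left`). Where the classical relation exchanges the first
two arguments, the deformed one composes with `𝓡⁻¹`: since `Δ` is cocommutative,
`(Δ ⊗ id)(𝓕⁻¹) 𝓕⁻¹₁₂ 𝓡⁻¹₁₂` is `(Δ ⊗ id)(𝓕⁻¹) 𝓕⁻¹₁₂` with its first two factors exchanged
(`twist_Rinv_star3`).

*Evaluation.* A 2-form `τ` is regarded as a covariant 2-tensor, and `⟨u ⊗ v, τ⟩_⋆` denotes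
`⟨u, ⟨v, τ⟩_⋆⟩_⋆` (`evalBi`). Comparing lowest orders in `λ`, where `𝓕` is trivial and the frame is
an ordinary one, shows that a 2-tensor is determined by its values on a frame; hence
`τ = ½ θ^j ∧_⋆ θ^i ⋆ ⟨e_i ⊗ e_j, τ⟩_⋆` (`eq_sum_wedge`). It remains to see that the right hand sides
of the structural equations evaluate to `-⟨T(u, v), θ^l⟩_⋆` and `-⟨R(u, v, e_k), θ^l⟩_⋆`.

*The identity.* In a frame the connection acts by
`⟨∇_u v, θ^l⟩_⋆ = 𝓛_u⟨v, θ^l⟩_⋆ + ⟨u ⊗ v, θ^k ⊗_⋆ ω_k^l⟩_⋆` (`pairing_nabla`), and therefore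
`⟨∇_u ∇_v e_k, θ^l⟩_⋆ = 𝓛_u⟨v, ω_k^l⟩_⋆ + ⟨u ⊗ v, ω_k^m ⊗_⋆ ω_m^l⟩_⋆`. Both have the form
`N(u, v) = 𝓛_u⟨v, α⟩_⋆ + ⟨u ⊗ v, β⟩_⋆`. By the deformed Cartan formula for `dα` and the deformed
transposition of `β`, the tensor `dα - β + βᵀ` evaluates to
`-(N(u, v) - N(R̄^α(v), R̄_α(u)) - ⟨[u, v]_⋆, α⟩_⋆)`, which is minus the torsion in the first
case and minus the curvature in the second.
-/

open scoped TensorProduct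

noncomputable section

namespace StarGeometry

/-! ### Cauchy products of formal series -/

theorem sum_antidiagonal_nested {M : Type*} [AddCommMonoid M] (f : ℕ → ℕ → ℕ → M) (n : ℕ) :
    ∑ p ∈ Finset.HasAntidiagonal.antidiagonal n,
        ∑ q ∈ Finset.HasAntidiagonal.antidiagonal p.1, f q.1 q.2 p.2 =
      ∑ p ∈ Finset.HasAntidiagonal.antidiagonal n,
        ∑ q ∈ Finset.HasAntidiagonal.antidiagonal p.2, f p.1 q.1 q.2 := by
  simp only [Finset.sum_sigma']
  refine Finset.sum_nbij' (fun x => ⟨(x.2.1, x.2.2 + x.1.2), (x.2.2, x.1.2)⟩)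
    (fun x => ⟨(x.1.1 + x.2.1, x.2.2), (x.1.1, x.2.1)⟩) ?_ ?_ ?_ ?_ (fun _ _ => rfl) <;>
  · rintro ⟨⟨i, j⟩, ⟨k, l⟩⟩ h
    simp only [Finset.mem_sigma, Finset.HasAntidiagonal.mem_antidiagonal] at h ⊢
    obtain ⟨h1, h2⟩ := h
    subst h1
    subst h2
    simp [add_assoc]

namespace Formal

variable {X Y Z W X' Y' Z' : Type*} [AddCommGroup X] [Module ℂ X] [AddCommGroup Y] [Module ℂ Y]
  [AddCommGroup Z] [Module ℂ Z] [AddCommGroup W] [Module ℂ W] [AddCommGroup X'] [Module ℂ X']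
  [AddCommGroup Y'] [Module ℂ Y'] [AddCommGroup Z'] [Module ℂ Z']

theorem map_map (f : X →ₗ[ℂ] Y) (f' : Y →ₗ[ℂ] Z) (x : Formal X) :
    map f' (map f x) = map (f'.comp f) x := rfl

theorem map_bilin (μ : X →ₗ[ℂ] Y →ₗ[ℂ] Z) (ν : X' →ₗ[ℂ] Y' →ₗ[ℂ] Z') (f : Z →ₗ[ℂ] Z')
    (f₁ : X →ₗ[ℂ] X') (f₂ : Y →ₗ[ℂ] Y') (h : ∀ x y, f (μ x y) = ν (f₁ x) (f₂ y))
    (x : Formal X) (y : Formal Y) : map f (bilin μ x y) = bilin ν (map f₁ x) (map f₂ y) := by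
  refine Formal.ext fun n => ?_
  rw [map_apply, bilin_apply, bilin_apply, map_sum]
  exact Finset.sum_congr rfl fun p _ => h _ _

theorem bilin_assoc {U V : Type*} [AddCommGroup U] [Module ℂ U] [AddCommGroup V] [Module ℂ V]
    (a : U →ₗ[ℂ] Z →ₗ[ℂ] W) (b : X →ₗ[ℂ] Y →ₗ[ℂ] U) (c : X →ₗ[ℂ] V →ₗ[ℂ] W)
    (d : Y →ₗ[ℂ] Z →ₗ[ℂ] V) (h : ∀ x y z, a (b x y) z = c x (d y z))
    (x : Formal X) (y : Formal Y) (z : Formal Z) :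
    bilin a (bilin b x y) z = bilin c x (bilin d y z) := by
  refine Formal.ext fun n => ?_
  simp only [bilin_apply, map_sum, LinearMap.sum_apply, h]
  exact sum_antidiagonal_nested (fun i j k => c (x i) (d (y j) (z k))) n

/-- The sum `∑ₖ λᵏ wₖ` of a sequence of formal series. -/
def lambdaSum (w : ℕ → Formal X) : Formal X := fun n =>
  ∑ p ∈ Finset.HasAntidiagonal.antidiagonal n, w p.1 p.2

/-- A map of formal series that commutes with the infinite sums `∑ₖ λᵏ wₖ`, that is, is
`ℂ[[λ]]`-linear and continuous in the `λ`-adic topology. -/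
def LambdaLinear (C : Formal X → Formal Y) : Prop :=
  ∀ w : ℕ → Formal X, C (lambdaSum w) = lambdaSum fun k => C (w k)

theorem lambdaLinear_map (f : X →ₗ[ℂ] Y) : LambdaLinear fun x => map f x := fun w => by
  refine Formal.ext fun n => ?_
  simp only [map_apply, lambdaSum, map_sum]

theorem lambdaLinear_bilin_left (μ : X →ₗ[ℂ] Y →ₗ[ℂ] Z) (y : Formal Y) :
    LambdaLinear fun x => bilin μ x y := fun w => by
  refine Formal.ext fun n => ?_
  simp only [bilin_apply, lambdaSum, map_sum, LinearMap.sum_apply]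
  exact sum_antidiagonal_nested (fun i j k => μ (w i j) (y k)) n

theorem lambdaLinear_bilin_right (μ : X →ₗ[ℂ] Y →ₗ[ℂ] Z) (x : Formal X) :
    LambdaLinear fun y => bilin μ x y := fun w => by
  refine Formal.ext fun n => ?_
  simp only [bilin_apply, lambdaSum, map_sum]
  rw [← sum_antidiagonal_nested (fun i j k => μ (x i) (w j k)) n,
    ← sum_antidiagonal_nested (fun j i k => μ (x i) (w j k)) n]
  refine Finset.sum_congr rfl fun p _ => ?_
  exact Finset.Nat.sum_antidiagonal_swap (f := fun q => μ (x q.2) (w q.1 p.2))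

/-- The formal series `x ⊗ y`. -/
def tmul (x : Formal X) (y : Formal Y) : Formal (X ⊗[ℂ] Y) :=
  bilin (TensorProduct.mk ℂ X Y) x y

theorem map_lift_tmul (μ : X →ₗ[ℂ] Y →ₗ[ℂ] Z) (x : Formal X) (y : Formal Y) :
    map (TensorProduct.lift μ) (tmul x y) = bilin μ x y :=
  map_bilin _ _ _ LinearMap.id LinearMap.id (fun _ _ => by simp) x y

theorem map_map_tmul (f : X →ₗ[ℂ] X') (f' : Y →ₗ[ℂ] Y') (x : Formal X) (y : Formal Y) :
    map (TensorProduct.map f f') (tmul x y) = tmul (map f x) (map f' y) :=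
  map_bilin _ _ _ f f' (fun _ _ => by simp) x y

theorem tmul_map_left (f : X →ₗ[ℂ] X') (x : Formal X) (y : Formal Y) :
    tmul (map f x) y = map (TensorProduct.map f LinearMap.id) (tmul x y) :=
  (map_map_tmul f LinearMap.id x y).symm

theorem tmul_map_right (f : Y →ₗ[ℂ] Y') (x : Formal X) (y : Formal Y) :
    tmul x (map f y) = map (TensorProduct.map LinearMap.id f) (tmul x y) :=
  (map_map_tmul LinearMap.id f x y).symm

theorem map_comm_tmul (x : Formal X) (y : Formal Y) :
    map (TensorProduct.comm ℂ X Y).toLinearMap (tmul x y) = tmul y x := by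
  refine Formal.ext fun n => ?_
  simp only [map_apply, tmul, bilin_apply, map_sum]
  exact Finset.Nat.sum_antidiagonal_swap (f := fun q => (y q.1) ⊗ₜ[ℂ] (x q.2))

theorem map_assoc_tmul (x : Formal X) (y : Formal Y) (z : Formal Z) :
    map (TensorProduct.assoc ℂ X Y Z).toLinearMap (tmul (tmul x y) z) = tmul x (tmul y z) := by
  rw [tmul, map_bilin _ ((TensorProduct.mk ℂ (X ⊗[ℂ] Y) Z).compr₂
    (TensorProduct.assoc ℂ X Y Z).toLinearMap) _ LinearMap.id LinearMap.id fun _ _ => rfl]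
  exact bilin_assoc _ _ _ _ (fun _ _ _ => rfl) x y z

/-! ### Power series acting on formal series -/

variable {R S : Type*} [Ring R] [Algebra ℂ R] [Ring S] [Algebra ℂ S]

/-- The action of `ξ = ∑ₖ λᵏ ξₖ ∈ R[[λ]]` on `X[[λ]]` induced by a representation of `R`
on `X`. -/
def psAct (φ : R →ₐ[ℂ] Module.End ℂ X) (ξ : PowerSeries R) (x : Formal X) : Formal X :=
  bilin φ.toLinearMap (fun n => PowerSeries.coeff n ξ) x

theorem psAct_mul (φ : R →ₐ[ℂ] Module.End ℂ X) (ξ ζ : PowerSeries R) (x : Formal X) :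
    psAct φ (ξ * ζ) x = psAct φ ξ (psAct φ ζ x) := by
  have h : (fun n => PowerSeries.coeff n (ξ * ζ) : Formal R) =
      bilin (LinearMap.mul ℂ R) (fun n => PowerSeries.coeff n ξ)
        (fun n => PowerSeries.coeff n ζ) :=
    funext fun n => PowerSeries.coeff_mul n ξ ζ
  rw [psAct, h]
  exact bilin_assoc _ _ _ _ (fun a b x => by simp) _ _ _

theorem psAct_eq_lambdaSum (φ : R →ₐ[ℂ] Module.End ℂ X) (ξ : PowerSeries R) (x : Formal X) :
    psAct φ ξ x = lambdaSum fun k => map (φ (PowerSeries.coeff k ξ)) x := rfl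

theorem lambdaLinear_psAct (φ : R →ₐ[ℂ] Module.End ℂ X) (ξ : PowerSeries R) :
    LambdaLinear fun x => psAct φ ξ x := lambdaLinear_bilin_right _ _

theorem map_psAct (φ : R →ₐ[ℂ] Module.End ℂ X) (ψ : S →ₐ[ℂ] Module.End ℂ Y) (χ : R →ₐ[ℂ] S)
    (f : X →ₗ[ℂ] Y) (h : ∀ a x, f (φ a x) = ψ (χ a) (f x)) (ξ : PowerSeries R) (x : Formal X) :
    map f (psAct φ ξ x) = psAct ψ (PowerSeries.map χ.toRingHom ξ) (map f x) :=
  map_bilin _ _ f χ.toLinearMap f (fun a x => h a x) _ x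

/-- The counterpart of `map_psAct` for a map `f` along which the action of `a` lifts to that of
`χ a`. -/
theorem psAct_map (φ : R →ₐ[ℂ] Module.End ℂ X) (ψ : S →ₐ[ℂ] Module.End ℂ Y) (χ : R →ₐ[ℂ] S)
    (f : Y →ₗ[ℂ] X) (h : ∀ a y, φ a (f y) = f (ψ (χ a) y)) (ξ : PowerSeries R) (y : Formal Y) :
    psAct φ ξ (map f y) = map f (psAct ψ (PowerSeries.map χ.toRingHom ξ) y) := by
  rw [psAct_eq_lambdaSum, psAct_eq_lambdaSum]
  refine Eq.trans (congrArg lambdaSum (funext fun k => Formal.ext fun n => ?_))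
    (lambdaLinear_map f _).symm
  simp only [map_apply, PowerSeries.coeff_map]
  exact h _ _

/-- The representation of `R ⊗ S` on `X ⊗ Y`. -/
def tensorRep (φ : R →ₐ[ℂ] Module.End ℂ X) (ψ : S →ₐ[ℂ] Module.End ℂ Y) :
    R ⊗[ℂ] S →ₐ[ℂ] Module.End ℂ (X ⊗[ℂ] Y) :=
  Module.endTensorEndAlgHom.comp (Algebra.TensorProduct.map φ ψ)

theorem tensorRep_tmul (φ : R →ₐ[ℂ] Module.End ℂ X) (ψ : S →ₐ[ℂ] Module.End ℂ Y) (a : R) (b : S) :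
    tensorRep φ ψ (a ⊗ₜ b) = TensorProduct.map (φ a) (ψ b) := by
  rw [tensorRep, AlgHom.comp_apply, Algebra.TensorProduct.map_tmul,
    Module.endTensorEndAlgHom_apply]
  rfl

theorem tmul_psAct_left (φ : R →ₐ[ℂ] Module.End ℂ X) (ψ : S →ₐ[ℂ] Module.End ℂ Y)
    (ξ : PowerSeries R) (x : Formal X) (y : Formal Y) :
    tmul (psAct φ ξ x) y = psAct (tensorRep φ ψ)
      (PowerSeries.map (Algebra.TensorProduct.includeLeft : R →ₐ[ℂ] R ⊗[ℂ] S).toRingHom ξ)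
      (tmul x y) := by
  rw [psAct_eq_lambdaSum, psAct_eq_lambdaSum]
  refine (lambdaLinear_bilin_left _ y _).trans (congrArg _ (funext fun k => ?_))
  rw [PowerSeries.coeff_map]
  change tmul _ y = map (tensorRep φ ψ (PowerSeries.coeff k ξ ⊗ₜ 1)) _
  rw [tensorRep_tmul, map_map_tmul, map_one]
  rfl

theorem tmul_psAct_right (φ : R →ₐ[ℂ] Module.End ℂ X) (ψ : S →ₐ[ℂ] Module.End ℂ Y)
    (ξ : PowerSeries S) (x : Formal X) (y : Formal Y) :
    tmul x (psAct ψ ξ y) = psAct (tensorRep φ ψ)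
      (PowerSeries.map (Algebra.TensorProduct.includeRight : S →ₐ[ℂ] R ⊗[ℂ] S).toRingHom ξ)
      (tmul x y) := by
  rw [psAct_eq_lambdaSum, psAct_eq_lambdaSum]
  refine (lambdaLinear_bilin_right _ x _).trans (congrArg _ (funext fun k => ?_))
  rw [PowerSeries.coeff_map]
  change tmul x _ = map (tensorRep φ ψ (1 ⊗ₜ PowerSeries.coeff k ξ)) _
  rw [tensorRep_tmul, map_map_tmul, map_one]
  rfl

end Formal

/-! ### The threefold twist -/

section Triple

variable {g : Type*} [LieRing g] [LieAlgebra ℂ g]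

attribute [local instance] LieRing.ofAssociativeRing

theorem comul_ι (t : g) : comul g (UniversalEnvelopingAlgebra.ι ℂ t) =
    UniversalEnvelopingAlgebra.ι ℂ t ⊗ₜ[ℂ] 1 + 1 ⊗ₜ[ℂ] UniversalEnvelopingAlgebra.ι ℂ t := by
  simp [comul]

/-- The coproduct of `Ug` is cocommutative. -/
theorem comm_comul (a : Ug g) :
    Algebra.TensorProduct.comm ℂ (Ug g) (Ug g) (comul g a) = comul g a := by
  let S : Subalgebra ℂ (Ug g) := AlgHom.equalizer
    ((Algebra.TensorProduct.comm ℂ (Ug g) (Ug g)).toAlgHom.comp (comul g)) (comul g)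
  refine U_induction S (fun t => ?_) a
  change Algebra.TensorProduct.comm ℂ (Ug g) (Ug g) (comul g _) = comul g _
  rw [comul_ι, map_add, Algebra.TensorProduct.comm_tmul, Algebra.TensorProduct.comm_tmul,
    add_comm]

variable (F : Twist g)

/-- `(Δ ⊗ id)(𝓕⁻¹) 𝓕⁻¹₁₂`, by which iterated ⋆-operations bracketed to the left are deformed. -/
def Twist.tripleLeft : PowerSeries ((Ug g ⊗[ℂ] Ug g) ⊗[ℂ] Ug g) :=
  PowerSeries.map (Algebra.TensorProduct.map (comul g) (AlgHom.id ℂ (Ug g))).toRingHom F.inv *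
    PowerSeries.map (Algebra.TensorProduct.includeLeft :
      Ug g ⊗[ℂ] Ug g →ₐ[ℂ] (Ug g ⊗[ℂ] Ug g) ⊗[ℂ] Ug g).toRingHom F.inv

/-- `(id ⊗ Δ)(𝓕⁻¹) 𝓕⁻¹₂₃`, by which iterated ⋆-operations bracketed to the right are deformed. -/
def Twist.tripleRight : PowerSeries (Ug g ⊗[ℂ] (Ug g ⊗[ℂ] Ug g)) :=
  PowerSeries.map (Algebra.TensorProduct.map (AlgHom.id ℂ (Ug g)) (comul g)).toRingHom F.inv *
    PowerSeries.map (Algebra.TensorProduct.includeRight :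
      Ug g ⊗[ℂ] Ug g →ₐ[ℂ] Ug g ⊗[ℂ] (Ug g ⊗[ℂ] Ug g)).toRingHom F.inv

theorem map_mul_map_mul_eq_one {R S : Type*} [Semiring R] [Semiring S] (f f' : R →+* S) {a b : R}
    (h : a * b = 1) : f' a * f a * (f b * f' b) = 1 := by
  rw [mul_assoc, ← mul_assoc (f a), ← map_mul, h, map_one, one_mul, ← map_mul, h, map_one]

/-- The cocycle condition for `𝓕⁻¹`. -/
theorem Twist.map_assoc_tripleLeft :
    PowerSeries.map (Algebra.TensorProduct.assoc ℂ ℂ ℂ (Ug g) (Ug g) (Ug g)).toAlgHom.toRingHom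
      F.tripleLeft = F.tripleRight := by
  have h1 : F.inv * (F.F : UU g) = 1 := F.F.inv_mul
  have h2 : (F.F : UU g) * F.inv = 1 := F.F.mul_inv
  refine left_inv_eq_right_inv
    (a := PowerSeries.map (Algebra.TensorProduct.assoc ℂ ℂ ℂ (Ug g) (Ug g)
      (Ug g)).toAlgHom.toRingHom
      (PowerSeries.map (Algebra.TensorProduct.includeLeft :
          Ug g ⊗[ℂ] Ug g →ₐ[ℂ] (Ug g ⊗[ℂ] Ug g) ⊗[ℂ] Ug g).toRingHom (F.F : UU g) *
        PowerSeries.map (Algebra.TensorProduct.map (comul g) (AlgHom.id ℂ (Ug g))).toRingHom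
          (F.F : UU g))) ?_ ?_
  · rw [← map_mul, Twist.tripleLeft]
    exact (congrArg _ (map_mul_map_mul_eq_one _ _ h1)).trans (map_one _)
  · rw [F.cocycle, Twist.tripleRight]
    exact map_mul_map_mul_eq_one _ _ h2

theorem Twist.inv_mul_Rinv : F.inv * F.Rinv = flipUU g F.inv := by
  have h : F.Rinv = (F.F : UU g) * flipUU g F.inv := by
    rw [Twist.Rinv, Twist.R, mul_inv_rev, inv_inv, ← map_inv]
    rfl
  rw [h, ← mul_assoc]
  have h1 : F.inv * (F.F : UU g) = 1 := F.F.inv_mul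
  rw [h1, one_mul]

/-- Composing with `𝓡⁻¹` in the first two factors exchanges them, because `Δ` is
cocommutative. -/
theorem Twist.tripleLeft_mul_Rinv :
    F.tripleLeft * PowerSeries.map (Algebra.TensorProduct.includeLeft :
      Ug g ⊗[ℂ] Ug g →ₐ[ℂ] (Ug g ⊗[ℂ] Ug g) ⊗[ℂ] Ug g).toRingHom F.Rinv =
    PowerSeries.map (Algebra.TensorProduct.map
      (Algebra.TensorProduct.comm ℂ (Ug g) (Ug g)).toAlgHom (AlgHom.id ℂ (Ug g))).toRingHom
      F.tripleLeft := by
  rw [Twist.tripleLeft, mul_assoc, ← map_mul, F.inv_mul_Rinv, map_mul]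
  congr 1
  · ext n : 1
    simp only [PowerSeries.coeff_map]
    generalize PowerSeries.coeff n F.inv = ζ
    change Algebra.TensorProduct.map (comul g) (AlgHom.id ℂ (Ug g)) ζ =
      Algebra.TensorProduct.map (Algebra.TensorProduct.comm ℂ (Ug g) (Ug g)).toAlgHom
        (AlgHom.id ℂ (Ug g)) (Algebra.TensorProduct.map (comul g) (AlgHom.id ℂ (Ug g)) ζ)
    induction ζ using TensorProduct.induction_on with
    | zero => simp
    | add ζ ζ' h1 h2 => simp only [map_add, ← h1, ← h2]
    | tmul a b =>
      rw [Algebra.TensorProduct.map_tmul, Algebra.TensorProduct.map_tmul]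
      congr 1
      exact (comm_comul a).symm

end Triple

/-! ### Associativity and braiding of ⋆-operations -/

section Star3

variable {g : Type*} [LieRing g] [LieAlgebra ℂ g] {A : Type*} [CommRing A] [Algebra ℂ A]
  {X Y Z V W : Type*}
  [AddCommGroup X] [Module ℂ X] [LieRingModule (VF A) X] [LieModule ℂ (VF A) X]
  [AddCommGroup Y] [Module ℂ Y] [LieRingModule (VF A) Y] [LieModule ℂ (VF A) Y]
  [AddCommGroup Z] [Module ℂ Z] [LieRingModule (VF A) Z] [LieModule ℂ (VF A) Z]
  [AddCommGroup V] [Module ℂ V] [LieRingModule (VF A) V] [LieModule ℂ (VF A) V]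
  [AddCommGroup W] [Module ℂ W]

variable (A) in
/-- A bilinear map is equivariant if vector fields act on its values by the Leibniz rule. -/
def IsEquivariant (ν : X →ₗ[ℂ] Y →ₗ[ℂ] V) : Prop :=
  ∀ (u : VF A) (x : X) (y : Y), ⁅u, ν x y⁆ = ν ⁅u, x⁆ y + ν x ⁅u, y⁆

variable (F : Twist g) (ρ : g →ₗ⁅ℂ⁆ VF A)

/-- On the values of an equivariant bilinear map, `Ug` acts through the coproduct. -/
theorem act_lift {ν : X →ₗ[ℂ] Y →ₗ[ℂ] V} (hν : IsEquivariant A ν) (a : Ug g) :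
    ∀ w, act ρ V a (TensorProduct.lift ν w) =
      TensorProduct.lift ν (Formal.tensorRep (act ρ X) (act ρ Y) (comul g a) w) := by
  let S : Subalgebra ℂ (Ug g) :=
    { carrier := {a | ∀ w, act ρ V a (TensorProduct.lift ν w) =
        TensorProduct.lift ν (Formal.tensorRep (act ρ X) (act ρ Y) (comul g a) w)}
      mul_mem' := fun {a b} ha hb w => by
        rw [map_mul, map_mul, map_mul, Module.End.mul_apply, Module.End.mul_apply, hb, ha]
      add_mem' := fun {a b} ha hb w => by
        rw [map_add, map_add, map_add, LinearMap.add_apply, LinearMap.add_apply, map_add, ha, hb]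
      algebraMap_mem' := fun c w => by
        rw [AlgHom.commutes, AlgHom.commutes, AlgHom.commutes, Module.algebraMap_end_apply,
          Module.algebraMap_end_apply, map_smul] }
  refine U_induction S (fun t w => ?_) a
  rw [act_ι, comul_ι, map_add, Formal.tensorRep_tmul, Formal.tensorRep_tmul, map_one, map_one]
  induction w using TensorProduct.induction_on with
  | zero => simp
  | add w w' h1 h2 => rw [map_add, lie_add, h1, h2, ← map_add, ← map_add]
  | tmul x y =>
    simp only [TensorProduct.lift.tmul, LinearMap.add_apply, TensorProduct.map_tmul, act_ι,
      Module.End.one_apply, map_add]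
    exact hν _ _ _

/-- If `B` factors through the tensor product of formal series by a `ℂ[[λ]]`-linear map, twisting
`B` amounts to acting on the tensor product. -/
theorem twist_eq_psAct (ξ : UU g) (B : Formal X →ₗ[ℂ] Formal Y →ₗ[ℂ] Formal W)
    (C : Formal (X ⊗[ℂ] Y) →ₗ[ℂ] Formal W) (hC : Formal.LambdaLinear C)
    (hB : ∀ x y, B x y = C (Formal.tmul x y)) (x : Formal X) (y : Formal Y) :
    twist ρ ξ B x y =
      C (Formal.psAct (Formal.tensorRep (act ρ X) (act ρ Y)) ξ (Formal.tmul x y)) := by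
  have h : ∀ ζ, twistTerm ρ B x y ζ =
      C (Formal.map (Formal.tensorRep (act ρ X) (act ρ Y) ζ) (Formal.tmul x y)) := by
    intro ζ
    induction ζ using TensorProduct.induction_on with
    | zero =>
      rw [map_zero, map_zero]
      exact (map_zero C).symm
    | add ζ ζ' h1 h2 =>
      rw [map_add, map_add, h1, h2, ← map_add]
      rfl
    | tmul a b =>
      rw [twistTerm_tmul, hB, Formal.tensorRep_tmul, Formal.map_map_tmul]
      rfl
  rw [Formal.psAct_eq_lambdaSum, hC]
  refine funext fun n => ?_
  rw [twist_apply]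
  exact Finset.sum_congr rfl fun p _ => by rw [h]

theorem starMap_eq_psAct (μ : X →ₗ[ℂ] Y →ₗ[ℂ] W) (x : Formal X) (y : Formal Y) :
    starMap F ρ μ x y = Formal.map (TensorProduct.lift μ)
      (Formal.psAct (Formal.tensorRep (act ρ X) (act ρ Y)) F.inv (Formal.tmul x y)) :=
  twist_eq_psAct ρ F.inv _ (Formal.map (TensorProduct.lift μ)) (Formal.lambdaLinear_map _)
    (fun x y => (Formal.map_lift_tmul μ x y).symm) x y

/-- The ⋆-deformation of a trilinear map. -/
def star3 (m : X ⊗[ℂ] (Y ⊗[ℂ] Z) →ₗ[ℂ] W) (x : Formal X) (y : Formal Y) (z : Formal Z) :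
    Formal W :=
  Formal.map m (Formal.psAct
    (Formal.tensorRep (act ρ X) (Formal.tensorRep (act ρ Y) (act ρ Z))) F.tripleRight
    (Formal.tmul x (Formal.tmul y z)))

/-- By the cocycle condition, the deformation of a trilinear map can be computed with either
bracketing of the tensor product. -/
theorem star3_eq_left (m : X ⊗[ℂ] (Y ⊗[ℂ] Z) →ₗ[ℂ] W) (x : Formal X) (y : Formal Y)
    (z : Formal Z) : star3 F ρ m x y z =
      Formal.map (m.comp (TensorProduct.assoc ℂ X Y Z).toLinearMap) (Formal.psAct
        (Formal.tensorRep (Formal.tensorRep (act ρ X) (act ρ Y)) (act ρ Z)) F.tripleLeft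
        (Formal.tmul (Formal.tmul x y) z)) := by
  rw [← Formal.map_map, Formal.map_psAct _
    (Formal.tensorRep (act ρ X) (Formal.tensorRep (act ρ Y) (act ρ Z)))
    (Algebra.TensorProduct.assoc ℂ ℂ ℂ (Ug g) (Ug g) (Ug g)).toAlgHom,
    F.map_assoc_tripleLeft, Formal.map_assoc_tmul, star3]
  intro a w
  induction a using TensorProduct.induction_on with
  | zero => simp
  | add a a' h1 h2 => simp only [map_add, LinearMap.add_apply, h1, h2]
  | tmul a c =>
    induction a using TensorProduct.induction_on with
    | zero => simp
    | add a a' h1 h2 => simp only [TensorProduct.add_tmul, map_add, LinearMap.add_apply, h1, h2]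
    | tmul a b =>
      change _ = Formal.tensorRep (act ρ X) (Formal.tensorRep (act ρ Y) (act ρ Z))
        (a ⊗ₜ (b ⊗ₜ c)) _
      simp only [Formal.tensorRep_tmul]
      exact LinearMap.congr_fun (TensorProduct.map_map_comp_assoc_eq _ _ _).symm w

theorem starMap_starMap_right {μ : X →ₗ[ℂ] V →ₗ[ℂ] W} {ν : Y →ₗ[ℂ] Z →ₗ[ℂ] V}
    (hν : IsEquivariant A ν) (m : X ⊗[ℂ] (Y ⊗[ℂ] Z) →ₗ[ℂ] W)
    (hm : ∀ x y z, m (x ⊗ₜ (y ⊗ₜ z)) = μ x (ν y z))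
    (x : Formal X) (y : Formal Y) (z : Formal Z) :
    starMap F ρ μ x (starMap F ρ ν y z) = star3 F ρ m x y z := by
  rw [starMap_eq_psAct, starMap_eq_psAct, Formal.tmul_map_right, Formal.tmul_psAct_right (act ρ X),
    Formal.psAct_map _ (Formal.tensorRep (act ρ X) (Formal.tensorRep (act ρ Y) (act ρ Z)))
      (Algebra.TensorProduct.map (AlgHom.id ℂ (Ug g)) (comul g)),
    Formal.map_map, ← Formal.psAct_mul, star3, Twist.tripleRight]
  · congr 2
    ext x y z
    simp [hm]
  · intro a w
    induction a using TensorProduct.induction_on with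
    | zero => simp
    | add a a' h1 h2 => simp only [map_add, LinearMap.add_apply, h1, h2]
    | tmul a b =>
      rw [Algebra.TensorProduct.map_tmul, Formal.tensorRep_tmul, Formal.tensorRep_tmul]
      induction w using TensorProduct.induction_on with
      | zero => simp
      | add w w' h1 h2 => rw [map_add, map_add, map_add, map_add, h1, h2]
      | tmul x w => simp [act_lift ρ hν]

theorem starMap_starMap_left {μ : V →ₗ[ℂ] Z →ₗ[ℂ] W} {ν : X →ₗ[ℂ] Y →ₗ[ℂ] V}
    (hν : IsEquivariant A ν) (m : X ⊗[ℂ] (Y ⊗[ℂ] Z) →ₗ[ℂ] W)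
    (hm : ∀ x y z, m (x ⊗ₜ (y ⊗ₜ z)) = μ (ν x y) z)
    (x : Formal X) (y : Formal Y) (z : Formal Z) :
    starMap F ρ μ (starMap F ρ ν x y) z = star3 F ρ m x y z := by
  rw [starMap_eq_psAct, starMap_eq_psAct, Formal.tmul_map_left, Formal.tmul_psAct_left _ (act ρ Z),
    Formal.psAct_map _ (Formal.tensorRep (Formal.tensorRep (act ρ X) (act ρ Y)) (act ρ Z))
      (Algebra.TensorProduct.map (comul g) (AlgHom.id ℂ (Ug g))),
    Formal.map_map, ← Formal.psAct_mul, star3_eq_left, Twist.tripleLeft]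
  · congr 2
    ext x y z
    simp [hm]
  · intro a w
    induction a using TensorProduct.induction_on with
    | zero => simp
    | add a a' h1 h2 => simp only [map_add, LinearMap.add_apply, h1, h2]
    | tmul a b =>
      rw [Algebra.TensorProduct.map_tmul, Formal.tensorRep_tmul, Formal.tensorRep_tmul]
      induction w using TensorProduct.induction_on with
      | zero => simp
      | add w w' h1 h2 => rw [map_add, map_add, map_add, map_add, h1, h2]
      | tmul w z => simp [act_lift ρ hν]

/-- An associativity law of equivariant bilinear maps passes to their ⋆-deformations. -/
theorem starMap_assoc {V' : Type*} [AddCommGroup V'] [Module ℂ V'] [LieRingModule (VF A) V']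
    [LieModule ℂ (VF A) V'] {μ : V →ₗ[ℂ] Z →ₗ[ℂ] W} {ν : X →ₗ[ℂ] Y →ₗ[ℂ] V}
    {μ' : X →ₗ[ℂ] V' →ₗ[ℂ] W} {ν' : Y →ₗ[ℂ] Z →ₗ[ℂ] V'} (hν : IsEquivariant A ν)
    (hν' : IsEquivariant A ν') (h : ∀ x y z, μ (ν x y) z = μ' x (ν' y z))
    (x : Formal X) (y : Formal Y) (z : Formal Z) :
    starMap F ρ μ (starMap F ρ ν x y) z = starMap F ρ μ' x (starMap F ρ ν' y z) := by
  rw [starMap_starMap_right F ρ hν' (TensorProduct.lift (μ'.compr₂ LinearMap.id) ∘ₗ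
      TensorProduct.map LinearMap.id (TensorProduct.lift ν')) (by simp),
    starMap_starMap_left F ρ hν (TensorProduct.lift (μ'.compr₂ LinearMap.id) ∘ₗ
      TensorProduct.map LinearMap.id (TensorProduct.lift ν')) (by simp [h])]

/-- Exchanging the first two arguments of a deformed trilinear map by means of `𝓡⁻¹` amounts to
exchanging the arguments of the classical map. -/
theorem twist_Rinv_star3 (m : Y ⊗[ℂ] (X ⊗[ℂ] Z) →ₗ[ℂ] W) (m' : X ⊗[ℂ] (Y ⊗[ℂ] Z) →ₗ[ℂ] W)
    (h : ∀ x y z, m' (x ⊗ₜ (y ⊗ₜ z)) = m (y ⊗ₜ (x ⊗ₜ z))) (z : Formal Z)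
    (B : Formal Y →ₗ[ℂ] Formal X →ₗ[ℂ] Formal W) (hB : ∀ y x, B y x = star3 F ρ m y x z)
    (x : Formal X) (y : Formal Y) : twist ρ F.Rinv B y x = star3 F ρ m' x y z := by
  -- `B` as a map on `(Y ⊗ X)[[λ]]`, with `z` fixed
  let C : Formal (Y ⊗[ℂ] X) →ₗ[ℂ] Formal W :=
    Formal.map (m.comp (TensorProduct.assoc ℂ Y X Z).toLinearMap) ∘ₗ
      Formal.bilin (Formal.tensorRep (Formal.tensorRep (act ρ Y) (act ρ X))
        (act ρ Z)).toLinearMap (fun n => PowerSeries.coeff n F.tripleLeft) ∘ₗ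
      (Formal.bilin (TensorProduct.mk ℂ (Y ⊗[ℂ] X) Z)).flip z
  have hC : ∀ w, C w = Formal.map (m.comp (TensorProduct.assoc ℂ Y X Z).toLinearMap)
      (Formal.psAct (Formal.tensorRep (Formal.tensorRep (act ρ Y) (act ρ X)) (act ρ Z))
        F.tripleLeft (Formal.tmul w z)) := fun _ => rfl
  have hC' : Formal.LambdaLinear C := fun w => by
    simp only [hC]
    rw [← Formal.lambdaLinear_map, ← Formal.lambdaLinear_psAct]
    exact congrArg (fun w => Formal.map _ (Formal.psAct _ _ w))
      (Formal.lambdaLinear_bilin_left _ z w)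
  have h1 : Formal.tmul (Formal.tmul y x) z =
      Formal.map (TensorProduct.map (TensorProduct.comm ℂ X Y).toLinearMap LinearMap.id)
        (Formal.tmul (Formal.tmul x y) z) := by
    rw [← Formal.tmul_map_left, Formal.map_comm_tmul]
  rw [twist_eq_psAct ρ F.Rinv B C hC' (fun y x => by rw [hB, star3_eq_left, hC]), hC,
    Formal.tmul_psAct_left _ (act ρ Z), ← Formal.psAct_mul, F.tripleLeft_mul_Rinv, h1,
    ← Formal.map_psAct (Formal.tensorRep (Formal.tensorRep (act ρ X) (act ρ Y)) (act ρ Z)),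
    Formal.map_map, star3_eq_left]
  · congr 1
    congr 1
    ext x y z
    simp [h]
  · intro a w
    induction a using TensorProduct.induction_on with
    | zero => simp
    | add a a' h1 h2 => simp only [map_add, LinearMap.add_apply, h1, h2]
    | tmul a c =>
      rw [Algebra.TensorProduct.map_tmul, Formal.tensorRep_tmul, Formal.tensorRep_tmul,
        ← LinearMap.comp_apply, ← LinearMap.comp_apply, ← TensorProduct.map_comp,
        ← TensorProduct.map_comp]
      congr 2
      induction a using TensorProduct.induction_on with
      | zero => ext; simp
      | add a a' h1 h2 => simp only [map_add, LinearMap.add_comp, LinearMap.comp_add, h1, h2]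
      | tmul a b =>
        ext x y
        change TensorProduct.comm ℂ X Y (Formal.tensorRep (act ρ X) (act ρ Y) (a ⊗ₜ b)
          (x ⊗ₜ y)) = Formal.tensorRep (act ρ Y) (act ρ X) (b ⊗ₜ a) (y ⊗ₜ x)
        simp only [Formal.tensorRep_tmul, TensorProduct.map_tmul, TensorProduct.comm_tmul]

end Star3

/-! ### Covariant 2-tensors -/

section BiForm

variable (A : Type*) [CommRing A] [Algebra ℂ A]

/-- Covariant 2-tensors: function-bilinear functionals `β(v)(u)` on pairs of vector fields. Unlike
2-forms they include the tensor products of 1-forms. -/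
def BiForm : Type _ := VF A →ₗ[A] OneForm A

instance : AddCommGroup (BiForm A) := inferInstanceAs (AddCommGroup (VF A →ₗ[A] OneForm A))

instance : Module ℂ (BiForm A) := inferInstanceAs (Module ℂ (VF A →ₗ[A] OneForm A))

instance : FunLike (BiForm A) (VF A) (OneForm A) :=
  inferInstanceAs (FunLike (VF A →ₗ[A] OneForm A) (VF A) (OneForm A))

instance : LinearMapClass (BiForm A) A (VF A) (OneForm A) :=
  inferInstanceAs (LinearMapClass (VF A →ₗ[A] OneForm A) A (VF A) (OneForm A))

variable {A}

theorem BiForm.ext {β β' : BiForm A} (h : ∀ v w, β v w = β' v w) : β = β' :=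
  LinearMap.ext fun v => LinearMap.ext fun w => h v w

theorem BiForm.add_apply (β β' : BiForm A) (v : VF A) : (β + β') v = β v + β' v := rfl
theorem BiForm.smul_apply (c : ℂ) (β : BiForm A) (v : VF A) : (c • β) v = c • β v := rfl
theorem BiForm.map_smul_complex (c : ℂ) (β : BiForm A) (v : VF A) : β (c • v) = c • β v :=
  LinearMap.map_smul_of_tower (show VF A →ₗ[A] OneForm A from β) c v

theorem lie_oneForm_apply (X : VF A) (α : OneForm A) (Y : VF A) :
    ⁅X, α⁆ Y = X (α Y) - α ⁅X, Y⁆ := rfl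

theorem lie_smul_oneForm (X : VF A) (f : A) (α : OneForm A) :
    ⁅X, f • α⁆ = X f • α + f • ⁅X, α⁆ := by
  ext Y
  simp only [lie_oneForm_apply, LinearMap.smul_apply, LinearMap.add_apply, smul_eq_mul,
    Derivation.leibniz]
  ring

/-- The Lie derivative `(L_X β)(Y) = L_X(β(Y)) - β([X, Y])` of covariant 2-tensors. -/
def lieDerivBi (X : VF A) (β : BiForm A) : BiForm A :=
  show VF A →ₗ[A] OneForm A from
  { toFun := fun Y => ⁅X, β Y⁆ - β ⁅X, Y⁆
    map_add' := fun Y Y' => by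
      simp only [map_add, lie_add]
      abel
    map_smul' := fun f Y => by
      simp only [lie_smul_VF, map_smul, map_add, lie_smul_oneForm, RingHom.id_apply, smul_sub]
      abel }

theorem lieDerivBi_apply (X : VF A) (β : BiForm A) (Y : VF A) :
    lieDerivBi X β Y = ⁅X, β Y⁆ - β ⁅X, Y⁆ := rfl

instance : LieRingModule (VF A) (BiForm A) where
  bracket := lieDerivBi
  add_lie X X' β := by
    refine LinearMap.ext fun Y => ?_
    change lieDerivBi (X + X') β Y = lieDerivBi X β Y + lieDerivBi X' β Y
    simp only [lieDerivBi_apply, add_lie, map_add]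
    abel
  lie_add X β β' := by
    refine LinearMap.ext fun Y => ?_
    change lieDerivBi X (β + β') Y = lieDerivBi X β Y + lieDerivBi X β' Y
    simp only [lieDerivBi_apply, BiForm.add_apply, lie_add]
    abel
  leibniz_lie X X' β := by
    refine LinearMap.ext fun Y => ?_
    change lieDerivBi X (lieDerivBi X' β) Y =
      lieDerivBi ⁅X, X'⁆ β Y + lieDerivBi X' (lieDerivBi X β) Y
    simp only [lieDerivBi_apply, lie_sub, lie_lie, map_sub]
    abel

theorem lie_biForm_apply (X : VF A) (β : BiForm A) (Y : VF A) :
    ⁅X, β⁆ Y = ⁅X, β Y⁆ - β ⁅X, Y⁆ := rfl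

instance : LieModule ℂ (VF A) (BiForm A) where
  smul_lie c X β := by
    refine LinearMap.ext fun Y => ?_
    change ⁅c • X, β⁆ Y = c • ⁅X, β⁆ Y
    simp only [lie_biForm_apply, smul_lie, BiForm.map_smul_complex, smul_sub]
  lie_smul c X β := by
    refine LinearMap.ext fun Y => ?_
    change ⁅X, c • β⁆ Y = c • ⁅X, β⁆ Y
    simp only [lie_biForm_apply, BiForm.smul_apply, smul_sub]
    exact congrArg (· - _) (lie_smul c X (β Y))

/-- `h, α ↦ h α` for a function `h` and a 1-form `α`. -/
def smulForm : A →ₗ[ℂ] OneForm A →ₗ[ℂ] OneForm A := mulForm.flip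

/-- The contraction `v, β ↦ β(v)`. -/
def contract : VF A →ₗ[ℂ] BiForm A →ₗ[ℂ] OneForm A :=
  LinearMap.mk₂ ℂ (fun v β => β v) (fun _ _ β => map_add β _ _)
    (fun c v β => BiForm.map_smul_complex c β v) (fun _ _ _ => rfl) (fun _ _ _ => rfl)

/-- The tensor product `(α ⊗ η)(v) = α(v) η` of 1-forms. -/
def tensorForm : OneForm A →ₗ[ℂ] OneForm A →ₗ[ℂ] BiForm A :=
  LinearMap.mk₂ ℂ (fun α η => show VF A →ₗ[A] OneForm A from α.smulRight η)
    (fun _ _ _ => LinearMap.ext fun _ => add_smul _ _ _)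
    (fun c _ _ => LinearMap.ext fun _ => smul_assoc c _ _)
    (fun _ _ _ => LinearMap.ext fun _ => smul_add _ _ _)
    (fun c _ _ => LinearMap.ext fun _ => smul_comm _ c _)

/-- The transposition of covariant 2-tensors. -/
def flipForm : BiForm A →ₗ[ℂ] BiForm A where
  toFun β := show VF A →ₗ[A] OneForm A from LinearMap.flip (show VF A →ₗ[A] OneForm A from β)
  map_add' _ _ := rfl
  map_smul' _ _ := rfl

theorem update_vec_zero {V : Type*} (v w x : V) : Function.update ![v, w] 0 x = ![x, w] := by
  funext i
  fin_cases i <;> rfl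

theorem update_vec_one {V : Type*} (v w x : V) : Function.update ![v, w] 1 x = ![v, x] := by
  funext i
  fin_cases i <;> rfl

/-- A 2-form as a covariant 2-tensor. -/
def ofTwoForm : TwoForm A →ₗ[ℂ] BiForm A where
  toFun τ := show VF A →ₗ[A] OneForm A from LinearMap.mk₂ A (fun v w => τ ![v, w])
    (fun v v' w => by
      have h := τ.map_update_add ![v, w] 0 v v'
      simpa only [update_vec_zero] using h)
    (fun c v w => by
      have h := τ.map_update_smul ![v, w] 0 c v
      simpa only [update_vec_zero] using h)
    (fun v w w' => by
      have h := τ.map_update_add ![v, w] 1 w w'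
      simpa only [update_vec_one] using h)
    (fun c v w => by
      have h := τ.map_update_smul ![v, w] 1 c w
      simpa only [update_vec_one] using h)
  map_add' _ _ := rfl
  map_smul' _ _ := rfl

theorem contract_apply (v : VF A) (β : BiForm A) : contract v β = β v := rfl
theorem tensorForm_apply (α η : OneForm A) (v : VF A) : tensorForm α η v = α v • η := rfl
theorem flipForm_apply (β : BiForm A) (v w : VF A) : flipForm β v w = β w v := rfl
theorem ofTwoForm_apply (τ : TwoForm A) (v w : VF A) : ofTwoForm τ v w = τ ![v, w] := rfl

theorem ofTwoForm_injective : Function.Injective (ofTwoForm (A := A)) := by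
  intro τ τ' h
  ext v
  -- a vector indexed by `Fin 2` is the pair of its entries
  have h1 := DFunLike.congr_fun (DFunLike.congr_fun h (v 0)) (v 1)
  rw [ofTwoForm_apply, ofTwoForm_apply] at h1
  have h2 : ![v 0, v 1] = v := by
    ext i : 1
    fin_cases i <;> rfl
  rwa [h2] at h1

theorem ofTwoForm_wedge (α η : OneForm A) :
    ofTwoForm (wedge α η) = tensorForm α η - flipForm (tensorForm α η) := by
  refine BiForm.ext fun v w => ?_
  change α v * η w - α w * η v = α v • η w - α w • η v
  rfl

theorem ofTwoForm_extD_apply (α : OneForm A) (v w : VF A) :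
    ofTwoForm (extD α) v w = v (α w) - w (α v) - α ⁅v, w⁆ := rfl

theorem flipForm_ofTwoForm (τ : TwoForm A) : flipForm (ofTwoForm τ) = -ofTwoForm τ := by
  refine BiForm.ext fun v w => ?_
  change τ ![w, v] = -τ ![v, w]
  have h := τ.map_swap ![v, w] (i := 0) (j := 1) (by decide)
  rw [← h]
  congr 1
  ext i : 1
  fin_cases i <;> rfl

theorem flipForm_lie (X : VF A) (β : BiForm A) : flipForm ⁅X, β⁆ = ⁅X, flipForm β⁆ := by
  refine BiForm.ext fun v w => ?_
  simp only [flipForm_apply, lie_biForm_apply, LinearMap.sub_apply, lie_oneForm_apply]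
  ring

theorem ofTwoForm_extD_lie (X : VF A) (α : OneForm A) :
    ofTwoForm (extD ⁅X, α⁆) = ⁅X, ofTwoForm (extD α)⁆ := by
  refine BiForm.ext fun v w => ?_
  simp only [ofTwoForm_extD_apply, lie_biForm_apply, LinearMap.sub_apply, lie_oneForm_apply,
    Derivation.commutator_apply, map_sub, lie_lie]
  ring

theorem isEquivariant_smulVF : IsEquivariant A (smulVF (A := A)) := fun u h v =>
  lie_smul_VF u v h

theorem isEquivariant_pairing : IsEquivariant A (pairing (A := A)) := fun u v α => by
  change u (α v) = α ⁅u, v⁆ + (u (α v) - α ⁅u, v⁆)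
  ring

theorem isEquivariant_bracketVF : IsEquivariant A (bracketVF (A := A)) := fun u v w =>
  leibniz_lie u v w

theorem isEquivariant_smulForm : IsEquivariant A (smulForm (A := A)) := fun u h α =>
  lie_smul_oneForm u h α

theorem isEquivariant_mulForm : IsEquivariant A (mulForm (A := A)) := fun u α h =>
  (lie_smul_oneForm u h α).trans (add_comm _ _)

theorem isEquivariant_contract : IsEquivariant A (contract (A := A)) := fun u v β => by
  simp only [contract_apply, lie_biForm_apply]
  abel

theorem isEquivariant_tensorForm : IsEquivariant A (tensorForm (A := A)) := fun u α η => by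
  refine BiForm.ext fun v w => ?_
  simp only [lie_biForm_apply, LinearMap.add_apply, LinearMap.sub_apply, BiForm.add_apply,
    LinearMap.smul_apply, tensorForm_apply, lie_smul_oneForm, lie_oneForm_apply, smul_eq_mul]
  ring

/-- Precomposing with an equivariant linear map in the second argument preserves equivariance. -/
theorem IsEquivariant.compl₂ {X Y Y' V : Type*}
    [AddCommGroup X] [Module ℂ X] [LieRingModule (VF A) X]
    [AddCommGroup Y] [Module ℂ Y] [LieRingModule (VF A) Y]
    [AddCommGroup Y'] [Module ℂ Y'] [LieRingModule (VF A) Y']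
    [AddCommGroup V] [Module ℂ V] [LieRingModule (VF A) V]
    {ν : X →ₗ[ℂ] Y →ₗ[ℂ] V} (hν : IsEquivariant A ν) (f : Y' →ₗ[ℂ] Y)
    (hf : ∀ (u : VF A) y, f ⁅u, y⁆ = ⁅u, f y⁆) : IsEquivariant A (ν.compl₂ f) := fun u x y => by
  simp only [LinearMap.compl₂_apply, hν u, hf]

end BiForm

section StarLemmas

variable {g : Type*} [LieRing g] [LieAlgebra ℂ g] {A : Type*} [CommRing A] [Algebra ℂ A]
  {X Y Z W : Type*}
  [AddCommGroup X] [Module ℂ X] [LieRingModule (VF A) X] [LieModule ℂ (VF A) X]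
  [AddCommGroup Y] [Module ℂ Y] [LieRingModule (VF A) Y] [LieModule ℂ (VF A) Y]
  [AddCommGroup Z] [Module ℂ Z] [AddCommGroup W] [Module ℂ W]
  (F : Twist g) (ρ : g →ₗ⁅ℂ⁆ VF A)

/-! ### Linearity of ⋆-operations -/

theorem map_starMap (f : Z →ₗ[ℂ] W) (μ : X →ₗ[ℂ] Y →ₗ[ℂ] Z) (x : Formal X) (y : Formal Y) :
    Formal.map f (starMap F ρ μ x y) = starMap F ρ (μ.compr₂ f) x y := by
  rw [starMap_eq_psAct, starMap_eq_psAct, Formal.map_map]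
  congr 1
  congr 1
  ext x y
  simp

theorem starMap_map_right {Y' : Type*} [AddCommGroup Y'] [Module ℂ Y'] [LieRingModule (VF A) Y']
    [LieModule ℂ (VF A) Y'] (μ : X →ₗ[ℂ] Y →ₗ[ℂ] Z) (f : Y' →ₗ[ℂ] Y)
    (hf : ∀ (u : VF A) y, f ⁅u, y⁆ = ⁅u, f y⁆) (x : Formal X) (y : Formal Y') :
    starMap F ρ μ x (Formal.map f y) = starMap F ρ (μ.compl₂ f) x y :=
  (star_map ρ ρ F (μ.compl₂ f) μ LinearMap.id f LinearMap.id
    (fun _ _ => rfl) (fun _ _ => hf _ _) (fun _ _ => rfl) x y).symm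

theorem lambdaLinear_starMap_left (μ : X →ₗ[ℂ] Y →ₗ[ℂ] Z) (y : Formal Y) :
    Formal.LambdaLinear fun x => starMap F ρ μ x y := fun w => by
  simp only [starMap_eq_psAct]
  rw [← Formal.lambdaLinear_map, ← Formal.lambdaLinear_psAct]
  exact congrArg (fun w => Formal.map _ (Formal.psAct _ _ w))
    (Formal.lambdaLinear_bilin_left _ y w)

theorem twist_add (ξ : UU g) (B B' : Formal X →ₗ[ℂ] Formal Y →ₗ[ℂ] Formal Z) (x : Formal X)
    (y : Formal Y) : twist ρ ξ (B + B') x y = twist ρ ξ B x y + twist ρ ξ B' x y := by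
  have h : twistTerm ρ (B + B') x y = twistTerm ρ B x y + twistTerm ρ B' x y := by
    ext a b
    simp [twistTerm_tmul]
  refine Formal.ext fun n => ?_
  simp only [Formal.add_apply, twist_apply, h, LinearMap.add_apply, Finset.sum_add_distrib]

/-- A `ℂ[[λ]]`-linear map can be taken out of a twisted bilinear map, even if the latter is not
induced by a classical one. -/
theorem twist_compr₂ (ξ : UU g) (B : Formal X →ₗ[ℂ] Formal Y →ₗ[ℂ] Formal Z)
    (C : Formal Z →ₗ[ℂ] Formal W) (hC : Formal.LambdaLinear C) (x : Formal X) (y : Formal Y) :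
    twist ρ ξ (B.compr₂ C) x y = C (twist ρ ξ B x y) := by
  have h : ∀ ζ, twistTerm ρ (B.compr₂ C) x y ζ = C (twistTerm ρ B x y ζ) := by
    intro ζ
    induction ζ using TensorProduct.induction_on with
    | zero => simp
    | add ζ ζ' h1 h2 => simp only [map_add, h1, h2]
    | tmul a b => simp [twistTerm_tmul]
  have h1 : twist ρ ξ B x y =
      Formal.lambdaSum fun k => twistTerm ρ B x y (PowerSeries.coeff k ξ) := rfl
  rw [h1, hC]
  refine Formal.ext fun n => ?_
  simp only [twist_apply, h, Formal.lambdaSum]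

/-! ### Units -/

/-- The inverse twist inherits the counit normalizations. -/
theorem Twist.map_inv_eq_one {R : Type*} [Ring R] [Algebra ℂ R] (φ : Ug g ⊗[ℂ] Ug g →ₐ[ℂ] R)
    (h : PowerSeries.map φ.toRingHom (F.F : UU g) = 1) :
    PowerSeries.map φ.toRingHom F.inv = 1 := by
  have h1 : PowerSeries.map φ.toRingHom ((F.F : UU g) * F.inv) = 1 := by
    rw [Twist.inv, Units.mul_inv, map_one]
  rwa [map_mul, h, one_mul] at h1

theorem bilin_const_left (μ : X →ₗ[ℂ] Y →ₗ[ℂ] Z) (x : X) (y : Formal Y) :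
    Formal.bilin μ (Formal.const x) y = Formal.map (μ x) y := by
  refine Formal.ext fun n => ?_
  rw [Formal.bilin_apply, Formal.map_apply, Finset.sum_eq_single (0, n)]
  · rfl
  · rintro ⟨i, j⟩ hij hne
    rw [Finset.HasAntidiagonal.mem_antidiagonal] at hij
    have hi : i ≠ 0 := by
      rintro rfl
      exact hne (by rw [← hij]; simp)
    simp [Formal.const, hi]
  · simp

theorem bilin_const_right (μ : X →ₗ[ℂ] Y →ₗ[ℂ] Z) (x : Formal X) (y : Y) :
    Formal.bilin μ x (Formal.const y) = Formal.map (μ.flip y) x := by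
  refine Formal.ext fun n => ?_
  rw [Formal.bilin_apply, Formal.map_apply, Finset.sum_eq_single (n, 0)]
  · rfl
  · rintro ⟨i, j⟩ hij hne
    rw [Finset.HasAntidiagonal.mem_antidiagonal] at hij
    have hj : j ≠ 0 := by
      rintro rfl
      exact hne (by rw [← hij]; rfl)
    simp [Formal.const, hj]
  · simp

theorem psAct_one {R : Type*} [Ring R] [Algebra ℂ R] (φ : R →ₐ[ℂ] Module.End ℂ Z)
    (x : Formal Z) : Formal.psAct φ 1 x = x := by
  have h : (fun n => PowerSeries.coeff n (1 : PowerSeries R) : Formal R) = Formal.const 1 :=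
    funext fun n => PowerSeries.coeff_one n
  rw [Formal.psAct, h, bilin_const_left]
  simp only [AlgHom.toLinearMap_apply, map_one]
  rfl

/-- The constant function `1` is a left unit, because `𝓕` is normalized by the counit. -/
theorem starMap_one_left {μ : A →ₗ[ℂ] Y →ₗ[ℂ] Y} (hμ : ∀ y, μ 1 y = y) (y : Formal Y) :
    starMap F ρ μ (Formal.const 1) y = y := by
  rw [starMap_eq_psAct, Formal.tmul, bilin_const_left,
    Formal.psAct_map _ (act ρ Y) ((Algebra.TensorProduct.lid ℂ (Ug g)).toAlgHom.comp
      (Algebra.TensorProduct.map (counit g) (AlgHom.id ℂ (Ug g)))),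
    F.map_inv_eq_one _ F.counit_left, psAct_one, Formal.map_map]
  · refine Formal.ext fun n => ?_
    simp [Formal.map_apply, hμ]
  · intro a y
    induction a using TensorProduct.induction_on with
    | zero => simp
    | add a a' h1 h2 => simp only [map_add, LinearMap.add_apply, h1, h2]
    | tmul a b =>
      rw [Formal.tensorRep_tmul]
      simp [act_one, Algebra.algebraMap_eq_smul_one, TensorProduct.smul_tmul]

/-- The constant function `1` is a right unit, because `𝓕` is normalized by the counit. -/
theorem starMap_one_right {μ : X →ₗ[ℂ] A →ₗ[ℂ] X} (hμ : ∀ x, μ x 1 = x) (x : Formal X) :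
    starMap F ρ μ x (Formal.const 1) = x := by
  rw [starMap_eq_psAct, Formal.tmul, bilin_const_right,
    Formal.psAct_map _ (act ρ X) ((Algebra.TensorProduct.rid ℂ ℂ (Ug g)).toAlgHom.comp
      (Algebra.TensorProduct.map (AlgHom.id ℂ (Ug g)) (counit g))),
    F.map_inv_eq_one _ F.counit_right, psAct_one, Formal.map_map]
  · refine Formal.ext fun n => ?_
    simp [Formal.map_apply, hμ]
  · intro a x
    induction a using TensorProduct.induction_on with
    | zero => simp
    | add a a' h1 h2 => simp only [map_add, LinearMap.add_apply, h1, h2]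
    | tmul a b =>
      rw [Formal.tensorRep_tmul]
      simp [act_one, Algebra.algebraMap_eq_smul_one]

theorem const_zero {V : Type*} [AddCommGroup V] : Formal.const (0 : V) = 0 :=
  Formal.ext fun n => by simp [Formal.const, Formal.zero_apply]

theorem starMap_ite_left {μ : A →ₗ[ℂ] Y →ₗ[ℂ] Y} (hμ : ∀ y, μ 1 y = y) (p : Prop) [Decidable p]
    (y : Formal Y) :
    starMap F ρ μ (Formal.const (if p then 1 else 0)) y = if p then y else 0 := by
  split_ifs
  · exact starMap_one_left F ρ hμ y
  · rw [const_zero, map_zero, LinearMap.zero_apply]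

theorem starMap_ite_right {μ : X →ₗ[ℂ] A →ₗ[ℂ] X} (hμ : ∀ x, μ x 1 = x) (p : Prop) [Decidable p]
    (x : Formal X) :
    starMap F ρ μ x (Formal.const (if p then 1 else 0)) = if p then x else 0 := by
  split_ifs
  · exact starMap_one_right F ρ hμ x
  · rw [const_zero, map_zero]

/-! ### Non-degeneracy -/

theorem Twist.coeff_zero_inv : PowerSeries.coeff 0 F.inv = 1 := by
  have h : PowerSeries.constantCoeff ((F.F : UU g) * F.inv) = 1 := by
    rw [Twist.inv, Units.mul_inv, map_one]
  rw [map_mul, F.constantCoeff_eq, one_mul] at h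
  rw [PowerSeries.coeff_zero_eq_constantCoeff_apply, h]

/-- The coefficient of `λⁿ` in `μ(x, y)`, when `x = O(λⁿ)`. -/
theorem bilin_apply_of_left {μ : X →ₗ[ℂ] Y →ₗ[ℂ] Z} {x : Formal X} (y : Formal Y) {n : ℕ}
    (hx : ∀ i < n, x i = 0) : Formal.bilin μ x y n = μ (x n) (y 0) := by
  rw [Formal.bilin_apply, Finset.sum_eq_single (n, 0)]
  · rintro ⟨i, j⟩ hij hne
    rw [Finset.HasAntidiagonal.mem_antidiagonal] at hij
    have hi : i < n := by
      rcases Nat.eq_zero_or_pos j with rfl | hj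
      · exact absurd (by rw [← hij]; rfl) hne
      · simp only at hij
        omega
    rw [hx i hi, map_zero, LinearMap.zero_apply]
  · simp

/-- The coefficient of `λⁿ` in `μ(x, y)`, when `y = O(λⁿ)`. -/
theorem bilin_apply_of_right {μ : X →ₗ[ℂ] Y →ₗ[ℂ] Z} (x : Formal X) {y : Formal Y} {n : ℕ}
    (hy : ∀ i < n, y i = 0) : Formal.bilin μ x y n = μ (x 0) (y n) := by
  rw [Formal.bilin_apply, Finset.sum_eq_single (0, n)]
  · rintro ⟨i, j⟩ hij hne
    rw [Finset.HasAntidiagonal.mem_antidiagonal] at hij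
    have hj : j < n := by
      rcases Nat.eq_zero_or_pos i with rfl | hi
      · exact absurd (by rw [← hij]; simp) hne
      · simp only at hij
        omega
    rw [hy j hj, map_zero]
  · simp

theorem psAct_inv_apply (φ : Ug g ⊗[ℂ] Ug g →ₐ[ℂ] Module.End ℂ Z) {z : Formal Z} {n : ℕ}
    (hz : ∀ i < n, z i = 0) : Formal.psAct φ F.inv z n = z n := by
  refine (bilin_apply_of_right _ hz).trans ?_
  change φ (PowerSeries.coeff 0 F.inv) (z n) = z n
  rw [F.coeff_zero_inv, map_one]
  rfl

/-- The leading coefficient of `μ_⋆(x, y)`, when `x = O(λⁿ)`, is that of `μ`. -/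
theorem starMap_apply_of_left (μ : X →ₗ[ℂ] Y →ₗ[ℂ] Z) {x : Formal X} (y : Formal Y) {n : ℕ}
    (hx : ∀ i < n, x i = 0) : starMap F ρ μ x y n = μ (x n) (y 0) := by
  have h : ∀ i ≤ n, Formal.tmul x y i = x i ⊗ₜ[ℂ] y 0 := fun i hi =>
    bilin_apply_of_left y fun j hj => hx j (by omega)
  rw [starMap_eq_psAct, Formal.map_apply, psAct_inv_apply, h n le_rfl, TensorProduct.lift.tmul]
  intro i hi
  rw [h i hi.le, hx i hi, TensorProduct.zero_tmul]

/-- The leading coefficient of `μ_⋆(x, y)`, when `y = O(λⁿ)`, is that of `μ`. -/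
theorem starMap_apply_of_right (μ : X →ₗ[ℂ] Y →ₗ[ℂ] Z) (x : Formal X) {y : Formal Y} {n : ℕ}
    (hy : ∀ i < n, y i = 0) : starMap F ρ μ x y n = μ (x 0) (y n) := by
  have h : ∀ i ≤ n, Formal.tmul x y i = x 0 ⊗ₜ[ℂ] y i := fun i hi =>
    bilin_apply_of_right x fun j hj => hy j (by omega)
  rw [starMap_eq_psAct, Formal.map_apply, psAct_inv_apply, h n le_rfl, TensorProduct.lift.tmul]
  intro i hi
  rw [h i hi.le, hy i hi, TensorProduct.tmul_zero]

/-- If the classical limits of the `y j` separate the points of `X`, the `y j` separate the points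
of `X[[λ]]`. -/
theorem eq_zero_of_starMap_left {κ : Type*} (μ : X →ₗ[ℂ] Y →ₗ[ℂ] Z) (y : κ → Formal Y)
    (h : ∀ x, (∀ j, μ x (y j 0) = 0) → x = 0) {x : Formal X}
    (hx : ∀ j, starMap F ρ μ x (y j) = 0) : x = 0 := by
  refine Formal.ext fun n => ?_
  induction n using Nat.strong_induction_on with
  | _ n ih =>
    refine h _ fun j => ?_
    rw [← starMap_apply_of_left F ρ μ (y j) ih, hx]
    rfl

/-- If the classical limits of the `x j` separate the points of `Y`, the `x j` separate the points
of `Y[[λ]]`. -/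
theorem eq_zero_of_starMap_right {κ : Type*} (μ : X →ₗ[ℂ] Y →ₗ[ℂ] Z) (x : κ → Formal X)
    (h : ∀ y, (∀ j, μ (x j 0) y = 0) → y = 0) {y : Formal Y}
    (hy : ∀ j, starMap F ρ μ (x j) y = 0) : y = 0 := by
  refine Formal.ext fun n => ?_
  induction n using Nat.strong_induction_on with
  | _ n ih =>
    refine h _ fun j => ?_
    rw [← starMap_apply_of_right F ρ μ (x j) ih, hy]
    rfl

end StarLemmas

section Cartan

variable {g : Type*} [LieRing g] [LieAlgebra ℂ g] {A : Type*} [CommRing A] [Algebra ℂ A]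
  (F : Twist g) (ρ : g →ₗ⁅ℂ⁆ VF A)

/-! ### ⋆-Cartan calculus -/

theorem star_pairing_smul (h : Formal A) (v : Formal (VF A)) (α : Formal (OneForm A)) :
    starMap F ρ pairing (starMap F ρ smulVF h v) α =
      starMap F ρ mulFun h (starMap F ρ pairing v α) :=
  starMap_assoc F ρ isEquivariant_smulVF isEquivariant_pairing
    (fun h v α => α.map_smul h v) h v α

theorem star_pairing_mulForm (v : Formal (VF A)) (α : Formal (OneForm A)) (h : Formal A) :
    starMap F ρ pairing v (starMap F ρ mulForm α h) =
      starMap F ρ mulFun (starMap F ρ pairing v α) h :=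
  (starMap_assoc F ρ isEquivariant_pairing isEquivariant_mulForm
    (fun v α h => mul_comm (α v) h) v α h).symm

/-- The ⋆-evaluation `⟨u, ⟨v, β⟩_⋆⟩_⋆` of a covariant 2-tensor on two vector fields. -/
def evalBi (u v : Formal (VF A)) : Formal (BiForm A) →ₗ[ℂ] Formal A :=
  starMap F ρ pairing u ∘ₗ starMap F ρ contract v

theorem evalBi_apply (u v : Formal (VF A)) (β : Formal (BiForm A)) :
    evalBi F ρ u v β = starMap F ρ pairing u (starMap F ρ contract v β) := rfl

theorem evalBi_tensorForm (u v : Formal (VF A)) (α η : Formal (OneForm A)) :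
    evalBi F ρ u v (starMap F ρ tensorForm α η) =
      starMap F ρ pairing u (starMap F ρ smulForm (starMap F ρ pairing v α) η) := by
  rw [evalBi_apply, starMap_assoc F ρ isEquivariant_pairing isEquivariant_tensorForm
    (μ' := contract) (fun v α η => rfl)]

/-- Moving a function past a vector field: `R̄(h) ⋆ ⟨R̄(u), α⟩_⋆ = ⟨u, h ⋆ α⟩_⋆`. -/
theorem twist_Rinv_mul_pairing (α : Formal (OneForm A))
    (B : Formal A →ₗ[ℂ] Formal (VF A) →ₗ[ℂ] Formal A)
    (hB : ∀ h u, B h u = starMap F ρ mulFun h (starMap F ρ pairing u α))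
    (h : Formal A) (u : Formal (VF A)) :
    twist ρ F.Rinv B h u = starMap F ρ pairing u (starMap F ρ smulForm h α) := by
  rw [starMap_starMap_right F ρ isEquivariant_smulForm
    (TensorProduct.lift pairing ∘ₗ TensorProduct.map LinearMap.id (TensorProduct.lift smulForm))
    (by simp)]
  refine twist_Rinv_star3 F ρ
    (TensorProduct.lift mulFun ∘ₗ TensorProduct.map LinearMap.id (TensorProduct.lift pairing))
    _ (fun u h α => ?_) α B (fun h u => ?_) u h
  · rfl
  · rw [hB, starMap_starMap_right F ρ isEquivariant_pairing]
    simp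

/-- Transposing a covariant 2-tensor exchanges its arguments by means of `𝓡⁻¹`. -/
theorem evalBi_flipForm (β : Formal (BiForm A))
    (B : Formal (VF A) →ₗ[ℂ] Formal (VF A) →ₗ[ℂ] Formal A)
    (hB : ∀ v u, B v u = evalBi F ρ v u β) (u v : Formal (VF A)) :
    evalBi F ρ u v (Formal.map flipForm β) = twist ρ F.Rinv B v u := by
  rw [evalBi_apply, starMap_map_right F ρ contract flipForm flipForm_lie,
    starMap_starMap_right F ρ
    (isEquivariant_contract.compl₂ flipForm fun u β => flipForm_lie u β)
    (TensorProduct.lift pairing ∘ₗ TensorProduct.map LinearMap.id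
      (TensorProduct.lift (contract.compl₂ flipForm))) (by simp)]
  symm
  refine twist_Rinv_star3 F ρ
    (TensorProduct.lift pairing ∘ₗ TensorProduct.map LinearMap.id (TensorProduct.lift contract))
    _ (fun u v β => ?_) β B (fun v u => ?_) u v
  · rfl
  · rw [hB, evalBi_apply, starMap_starMap_right F ρ isEquivariant_contract]
    simp

/-- The Cartan formula
`⟨u ⊗ v, dα⟩_⋆ = -𝓛_u⟨v, α⟩_⋆ + 𝓛_{R̄(v)}⟨R̄(u), α⟩_⋆ + ⟨[u, v]_⋆, α⟩_⋆`. -/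
theorem evalBi_extD (α : Formal (OneForm A))
    (B : Formal (VF A) →ₗ[ℂ] Formal (VF A) →ₗ[ℂ] Formal A)
    (hB : ∀ v u, B v u = starMap F ρ applyVF v (starMap F ρ pairing u α))
    (u v : Formal (VF A)) :
    evalBi F ρ u v (Formal.map ofTwoForm (Formal.map extD α)) =
      -starMap F ρ applyVF u (starMap F ρ pairing v α) + twist ρ F.Rinv B v u +
        starMap F ρ pairing (starMap F ρ bracketVF u v) α := by
  let δ : OneForm A →ₗ[ℂ] BiForm A := ofTwoForm.comp extD
  -- the classical maps `u(α(v))`, `v(α(u))` and `α([u, v])`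
  let m₁ : VF A ⊗[ℂ] (VF A ⊗[ℂ] OneForm A) →ₗ[ℂ] A :=
    TensorProduct.lift applyVF ∘ₗ TensorProduct.map LinearMap.id (TensorProduct.lift pairing)
  let m₂ : VF A ⊗[ℂ] (VF A ⊗[ℂ] OneForm A) →ₗ[ℂ] A :=
    m₁ ∘ₗ (TensorProduct.leftComm ℂ (VF A) (VF A) (OneForm A)).toLinearMap
  let m₃ : VF A ⊗[ℂ] (VF A ⊗[ℂ] OneForm A) →ₗ[ℂ] A :=
    TensorProduct.lift pairing ∘ₗ TensorProduct.map (TensorProduct.lift bracketVF) LinearMap.id ∘ₗ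
      (TensorProduct.assoc ℂ (VF A) (VF A) (OneForm A)).symm.toLinearMap
  rw [evalBi_apply, Formal.map_map, starMap_map_right F ρ contract δ ofTwoForm_extD_lie,
    starMap_starMap_right F ρ
    (isEquivariant_contract.compl₂ δ fun u α => ofTwoForm_extD_lie u α) (-m₁ + m₂ + m₃),
    starMap_starMap_right F ρ isEquivariant_pairing m₁ (fun _ _ _ => rfl),
    starMap_starMap_left F ρ isEquivariant_bracketVF m₃ (fun _ _ _ => rfl),
    twist_Rinv_star3 F ρ m₁ m₂ (fun _ _ _ => rfl) α B (fun v u => by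
      rw [hB, starMap_starMap_right F ρ isEquivariant_pairing m₁ (fun _ _ _ => rfl)])]
  · rfl
  · intro u v α
    change -(u (α v)) + v (α u) + α ⁅u, v⁆ = v (α u) - u (α v) - α ⁅v, u⁆
    rw [← lie_skew u v, map_neg]
    ring

/-- Suppose that `N(u, v) = 𝓛_u⟨v, α⟩_⋆ + ⟨u ⊗ v, β⟩_⋆`. Then the tensor
`dα - β + βᵀ` evaluates to `-(N(u, v) - N(R̄(v), R̄(u)) - ⟨[u, v]_⋆, α⟩_⋆)`. Both structural
equations are instances of this identity. -/
theorem evalBi_extD_sub (α : Formal (OneForm A)) (β : Formal (BiForm A))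
    (N : Formal (VF A) →ₗ[ℂ] Formal (VF A) →ₗ[ℂ] Formal A)
    (hN : ∀ u v, N u v = starMap F ρ applyVF u (starMap F ρ pairing v α) + evalBi F ρ u v β)
    (u v : Formal (VF A)) :
    evalBi F ρ u v (Formal.map ofTwoForm (Formal.map extD α) - (β - Formal.map flipForm β)) =
      -(N u v - twist ρ F.Rinv N v u - starMap F ρ pairing (starMap F ρ bracketVF u v) α) := by
  -- `N = B + ⟨· ⊗ ·, β⟩_⋆`, and `𝓡⁻¹` acts on the two summands separately
  let B : Formal (VF A) →ₗ[ℂ] Formal (VF A) →ₗ[ℂ] Formal A :=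
    (starMap F ρ applyVF).compl₂ ((starMap F ρ pairing).flip α)
  have h1 : twist ρ F.Rinv N v u = twist ρ F.Rinv B v u + twist ρ F.Rinv (N - B) v u := by
    rw [← twist_add, add_sub_cancel]
  have h2 : ∀ v u, (N - B) v u = evalBi F ρ v u β := fun v u => by
    rw [LinearMap.sub_apply, LinearMap.sub_apply, hN]
    exact add_sub_cancel_left _ _
  rw [map_sub, map_sub, evalBi_extD F ρ α B (fun _ _ => rfl), evalBi_flipForm F ρ β _ h2, h1, hN]
  abel

/-! ### ⋆-dual frames -/

theorem eq_zero_of_apply_frame {ι : Type*} {e : ι → Formal (VF A)} (he : IsFrame e) {N : Type*}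
    [AddCommGroup N] [Module A N] (f : VF A →ₗ[A] N) (hf : ∀ i, f (e i 0) = 0) : f = 0 :=
  LinearMap.ext_on he.2 (by
    rintro _ ⟨i, rfl⟩
    exact hf i)

variable {F ρ} {ι : Type*} {e : ι → Formal (VF A)}
  {θ : ι → Formal (OneForm A)}

theorem eq_zero_of_pairing_frame (he : IsFrame e) {α : Formal (OneForm A)}
    (h : ∀ i, starMap F ρ pairing (e i) α = 0) : α = 0 := by
  have h1 := eq_zero_of_starMap_right F ρ pairing e (y := α)
  exact h1 (fun α hα => eq_zero_of_apply_frame he α hα) h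

theorem eq_zero_of_evalBi_frame (he : IsFrame e) {β : Formal (BiForm A)}
    (h : ∀ i j, evalBi F ρ (e i) (e j) β = 0) : β = 0 := by
  have h1 := eq_zero_of_starMap_right F ρ contract e (y := β)
  exact h1 (fun β hβ => eq_zero_of_apply_frame he (show VF A →ₗ[A] OneForm A from β) hβ)
    fun j => eq_zero_of_pairing_frame (F := F) (ρ := ρ) he fun i => h i j

variable [Fintype ι] [DecidableEq ι]

/-- The classical limit of the ⋆-dual frame is the dual frame of the classical limit, so that it
separates vector fields. -/
theorem eq_zero_of_pairing_dual (he : IsFrame e) (hθ : IsStarDual F ρ e θ) {v : Formal (VF A)}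
    (h : ∀ j, starMap F ρ pairing v (θ j) = 0) : v = 0 := by
  have h0 : ∀ i j, θ j 0 (e i 0) = if i = j then 1 else 0 := fun i j => by
    have h1 : starMap F ρ pairing (e i) (θ j) 0 = (if i = j then 1 else 0 : A) := by
      rw [hθ i j]
      rfl
    rw [← h1, starMap_apply_of_left F ρ pairing (n := 0) (θ j) (by simp)]
    rfl
  have h1 := eq_zero_of_starMap_left F ρ pairing θ (x := v)
  refine h1 (fun x hx => ?_) h
  have hx' : x ∈ Submodule.span A (Set.range fun i => e i 0) := he.2 ▸ Submodule.mem_top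
  obtain ⟨c, rfl⟩ := (Submodule.mem_span_range_iff_exists_fun A).1 hx'
  refine Finset.sum_eq_zero fun j _ => ?_
  have h2 : θ j 0 (∑ i, c i • e i 0) = 0 := hx j
  simp only [map_sum, map_smul, h0, smul_eq_mul, mul_ite, mul_one, mul_zero,
    Finset.sum_ite_eq', Finset.mem_univ, if_true] at h2
  rw [h2, zero_smul]

/-- The expansion of a vector field in a frame: `v = ⟨v, θ^k⟩_⋆ ⋆ e_k`. -/
theorem eq_sum_pairing_smul (he : IsFrame e) (hθ : IsStarDual F ρ e θ) (v : Formal (VF A)) :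
    v = ∑ k, starMap F ρ smulVF (starMap F ρ pairing v (θ k)) (e k) := by
  rw [← sub_eq_zero]
  refine eq_zero_of_pairing_dual he hθ fun l => ?_
  simp only [map_sub, map_sum, LinearMap.sub_apply, LinearMap.sum_apply, star_pairing_smul,
    hθ _ l, starMap_ite_right F ρ (μ := mulFun) (fun x => mul_one x), Finset.sum_ite_eq',
    Finset.mem_univ, if_true, sub_self]

/-- The expansion of a covariant 2-tensor in a frame. -/
theorem eq_sum_tensorForm (he : IsFrame e) (hθ : IsStarDual F ρ e θ) (β : Formal (BiForm A)) :
    β = ∑ i, ∑ j, starMap F ρ tensorForm (θ j)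
      (starMap F ρ mulForm (θ i) (evalBi F ρ (e i) (e j) β)) := by
  rw [← sub_eq_zero]
  refine eq_zero_of_evalBi_frame (F := F) (ρ := ρ) he fun a b => ?_
  have h : ∀ i j, evalBi F ρ (e a) (e b) (starMap F ρ tensorForm (θ j)
      (starMap F ρ mulForm (θ i) (evalBi F ρ (e i) (e j) β))) =
      if b = j then if a = i then evalBi F ρ (e i) (e j) β else 0 else 0 := fun i j => by
    rw [evalBi_tensorForm, hθ b j, starMap_ite_left F ρ (μ := smulForm) (fun x => one_smul A x),
      ← starMap_ite_left F ρ (μ := mulFun) (fun x => one_mul x) (a = i), ← hθ a i,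
      ← star_pairing_mulForm]
    split_ifs
    · rfl
    · exact map_zero _
  rw [map_sub, map_sum, sub_eq_zero]
  simp only [map_sum, h, Finset.sum_ite_eq, Finset.mem_univ, if_true]

theorem map_ofTwoForm_starMap_wedge (α η : Formal (OneForm A)) :
    Formal.map ofTwoForm (starMap F ρ wedge α η) =
      starMap F ρ tensorForm α η - Formal.map flipForm (starMap F ρ tensorForm α η) := by
  rw [map_starMap, map_starMap, starMap_eq_psAct, starMap_eq_psAct, starMap_eq_psAct]
  have h : TensorProduct.lift (wedge.compr₂ ofTwoForm) = TensorProduct.lift (tensorForm (A := A)) -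
      TensorProduct.lift (tensorForm.compr₂ flipForm) := by
    refine TensorProduct.ext' fun α η => ?_
    rw [LinearMap.sub_apply, TensorProduct.lift.tmul, TensorProduct.lift.tmul,
      TensorProduct.lift.tmul]
    exact ofTwoForm_wedge α η
  rw [h]
  rfl

theorem map_ofTwoForm_injective {τ τ' : Formal (TwoForm A)}
    (h : Formal.map ofTwoForm τ = Formal.map ofTwoForm τ') : τ = τ' :=
  Formal.ext fun n => ofTwoForm_injective (congrFun h n)

/-- The expansion of a 2-form in a frame. -/
theorem eq_sum_wedge (he : IsFrame e) (hθ : IsStarDual F ρ e θ) (τ : Formal (TwoForm A)) :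
    τ = (1 / 2 : ℂ) • ∑ i, ∑ j, starMap F ρ wedge (θ j)
      (starMap F ρ mulForm (θ i) (evalBi F ρ (e i) (e j) (Formal.map ofTwoForm τ))) := by
  refine map_ofTwoForm_injective ?_
  rw [map_smul]
  simp only [map_sum, map_ofTwoForm_starMap_wedge, Finset.sum_sub_distrib]
  simp only [← map_sum]
  rw [← eq_sum_tensorForm he hθ]
  refine Formal.ext fun n => ?_
  simp only [Formal.smul_apply, Formal.sub_apply, Formal.map_apply, flipForm_ofTwoForm,
    sub_neg_eq_add]
  -- `β - βᵀ = 2 β` for the antisymmetric tensor `β` of a 2-form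
  rw [← two_smul ℂ, smul_smul]
  norm_num

/-! ### ⋆-covariant derivatives in a frame -/

variable {D : StarConnection F ρ} {Γ : ι → ι → ι → Formal A}

/-- `⟨∇_u e_k, θ^l⟩_⋆ = ⟨u, ω_k^l⟩_⋆`. -/
theorem pairing_nabla_frame (he : IsFrame e) (hθ : IsStarDual F ρ e θ)
    (hΓ : IsConnectionCoeff D e Γ) (u : Formal (VF A)) (k l : ι) :
    starMap F ρ pairing (D.nabla u (e k)) (θ l) =
      starMap F ρ pairing u (connectionForm F ρ θ Γ k l) := by
  conv_lhs => rw [eq_sum_pairing_smul he hθ u]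
  simp only [connectionForm, map_sum, LinearMap.sum_apply, D.smul_left, star_pairing_smul,
    star_pairing_mulForm, hΓ _ k]
  refine Finset.sum_congr rfl fun i _ => ?_
  rw [← map_sum]
  simp only [hθ _ l, starMap_ite_right F ρ (μ := mulFun) (fun x => mul_one x), Finset.sum_ite_eq',
    Finset.mem_univ, if_true]

/-- `⟨∇_u v, θ^l⟩_⋆ = 𝓛_u⟨v, θ^l⟩_⋆ + ⟨u, ⟨v, θ^k⟩_⋆ ⋆ ω_k^l⟩_⋆`. -/
theorem pairing_nabla (he : IsFrame e) (hθ : IsStarDual F ρ e θ) (hΓ : IsConnectionCoeff D e Γ)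
    (u v : Formal (VF A)) (l : ι) :
    starMap F ρ pairing (D.nabla u v) (θ l) =
      starMap F ρ applyVF u (starMap F ρ pairing v (θ l)) +
        ∑ k, starMap F ρ pairing u
          (starMap F ρ smulForm (starMap F ρ pairing v (θ k)) (connectionForm F ρ θ Γ k l)) := by
  have h1 : ∀ (h : Formal A) k, starMap F ρ pairing (twist ρ F.Rinv
      ((starMap F ρ smulVF).compl₂ (D.nabla.flip (e k))) h u) (θ l) =
      starMap F ρ pairing u (starMap F ρ smulForm h (connectionForm F ρ θ Γ k l)) := by
    intro h k
    rw [← twist_Rinv_mul_pairing F ρ (connectionForm F ρ θ Γ k l)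
      (((starMap F ρ smulVF).compl₂ (D.nabla.flip (e k))).compr₂
        ((starMap F ρ pairing).flip (θ l)))]
    · rw [twist_compr₂ ρ F.Rinv _ _ (lambdaLinear_starMap_left F ρ pairing (θ l))]
      rfl
    · intro h u
      rw [LinearMap.compr₂_apply, LinearMap.compl₂_apply, LinearMap.flip_apply,
        LinearMap.flip_apply, star_pairing_smul, pairing_nabla_frame he hθ hΓ]
  conv_lhs => rw [eq_sum_pairing_smul he hθ v]
  simp only [map_sum, LinearMap.sum_apply, D.leibniz, map_add, LinearMap.add_apply, h1,
    Finset.sum_add_distrib, star_pairing_smul, hθ _ l,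
    starMap_ite_right F ρ (μ := mulFun) (fun x => mul_one x), Finset.sum_ite_eq',
    Finset.mem_univ, if_true]

/-! ### The structural equations -/

/-- The ⋆-evaluation of `dθ^l - θ^k ∧_⋆ ω_k^l` is the torsion. -/
theorem evalBi_torsion (he : IsFrame e) (hθ : IsStarDual F ρ e θ) (hΓ : IsConnectionCoeff D e Γ)
    (u v : Formal (VF A)) (l : ι) :
    evalBi F ρ u v (Formal.map ofTwoForm (Formal.map extD (θ l) -
      ∑ k, starMap F ρ wedge (θ k) (connectionForm F ρ θ Γ k l))) =
      -starMap F ρ pairing (D.torsion u v) (θ l) := by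
  have h1 := evalBi_extD_sub F ρ (θ l)
    (∑ k, starMap F ρ tensorForm (θ k) (connectionForm F ρ θ Γ k l))
    (D.nabla.compr₂ ((starMap F ρ pairing).flip (θ l))) (fun u v => by
      rw [LinearMap.compr₂_apply, LinearMap.flip_apply, pairing_nabla he hθ hΓ, map_sum]
      simp only [evalBi_tensorForm]) u v
  rw [twist_compr₂ ρ F.Rinv _ _ (lambdaLinear_starMap_left F ρ pairing (θ l))] at h1
  simp only [map_sub, map_sum, map_ofTwoForm_starMap_wedge, Finset.sum_sub_distrib,
    StarConnection.torsion, LinearMap.sub_apply, LinearMap.compr₂_apply,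
    LinearMap.flip_apply] at h1 ⊢
  exact h1

/-- The ⋆-evaluation of `dω_k^l - ω_k^m ∧_⋆ ω_m^l` is the curvature. -/
theorem evalBi_curvature (he : IsFrame e) (hθ : IsStarDual F ρ e θ) (hΓ : IsConnectionCoeff D e Γ)
    (u v : Formal (VF A)) (k l : ι) :
    evalBi F ρ u v (Formal.map ofTwoForm (Formal.map extD (connectionForm F ρ θ Γ k l) -
      ∑ m, starMap F ρ wedge (connectionForm F ρ θ Γ k m) (connectionForm F ρ θ Γ m l))) =
      -starMap F ρ pairing (D.curvature u v (e k)) (θ l) := by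
  have h1 := evalBi_extD_sub F ρ (connectionForm F ρ θ Γ k l)
    (∑ m, starMap F ρ tensorForm (connectionForm F ρ θ Γ k m) (connectionForm F ρ θ Γ m l))
    ((D.nabla.compl₂ (D.nabla.flip (e k))).compr₂ ((starMap F ρ pairing).flip (θ l)))
    (fun u v => by
      rw [LinearMap.compr₂_apply, LinearMap.compl₂_apply, LinearMap.flip_apply,
        LinearMap.flip_apply, pairing_nabla he hθ hΓ, map_sum]
      simp only [evalBi_tensorForm, pairing_nabla_frame he hθ hΓ]) u v
  rw [twist_compr₂ ρ F.Rinv _ _ (lambdaLinear_starMap_left F ρ pairing (θ l)),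
    ← pairing_nabla_frame he hθ hΓ (starMap F ρ bracketVF u v)] at h1
  simp only [map_sub, map_sum, map_ofTwoForm_starMap_wedge, Finset.sum_sub_distrib,
    StarConnection.curvature, LinearMap.sub_apply, LinearMap.compr₂_apply, LinearMap.compl₂_apply,
    LinearMap.flip_apply] at h1 ⊢
  exact h1

theorem torsionForm_eq (he : IsFrame e) (hθ : IsStarDual F ρ e θ) (hΓ : IsConnectionCoeff D e Γ)
    (l : ι) : D.torsionForm e θ l = Formal.map extD (θ l) -
      ∑ k, starMap F ρ wedge (θ k) (connectionForm F ρ θ Γ k l) := by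
  rw [eq_sum_wedge he hθ (Formal.map extD (θ l) - _)]
  simp only [evalBi_torsion he hθ hΓ, StarConnection.torsionForm, StarConnection.torsionCoeff,
    map_neg, Finset.sum_neg_distrib, smul_neg, neg_smul]

theorem curvatureForm_eq (he : IsFrame e) (hθ : IsStarDual F ρ e θ) (hΓ : IsConnectionCoeff D e Γ)
    (k l : ι) : D.curvatureForm e θ k l = Formal.map extD (connectionForm F ρ θ Γ k l) -
      ∑ m, starMap F ρ wedge (connectionForm F ρ θ Γ k m) (connectionForm F ρ θ Γ m l) := by
  rw [eq_sum_wedge he hθ (Formal.map extD (connectionForm F ρ θ Γ k l) - _)]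
  simp only [evalBi_curvature he hθ hΓ, StarConnection.curvatureForm,
    StarConnection.curvatureCoeff, map_neg, Finset.sum_neg_distrib, smul_neg, neg_smul]

end Cartan

end StarGeometry

end

theorem mainTheorem1 {n : ℕ} {M : Type*} [TopologicalSpace M] [T2Space M]
    [ChartedSpace (EuclideanSpace ℝ (Fin n)) M] [IsManifold (𝓡 n) ∞ M]
    {g : Type*} [LieRing g] [LieAlgebra ℂ g] (F : Twist g) (ρ : g →ₗ⁅ℂ⁆ VF (Fn n M))
    (D : StarConnection F ρ) (W : Opens M) {ι : Type*} [Fintype ι] [DecidableEq ι]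
    (e : ι → Formal (VF (Fn n W))) (θ : ι → Formal (OneForm (Fn n W)))
    (he : IsFrame e) (hθ : IsStarDual F ((restrictVF n W).comp ρ) e θ)
    (Γ : ι → ι → ι → Formal (Fn n W)) (hΓ : IsConnectionCoeff (D.restrict W) e Γ) :
    (∀ l, (D.restrict W).torsionForm e θ l = Formal.map extD (θ l) -
      ∑ k, starMap F ((restrictVF n W).comp ρ) wedge (θ k)
        (connectionForm F ((restrictVF n W).comp ρ) θ Γ k l)) ∧
    (∀ k l, (D.restrict W).curvatureForm e θ k l =
      Formal.map extD (connectionForm F ((restrictVF n W).comp ρ) θ Γ k l) -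
      ∑ m, starMap F ((restrictVF n W).comp ρ) wedge
        (connectionForm F ((restrictVF n W).comp ρ) θ Γ k m)
        (connectionForm F ((restrictVF n W).comp ρ) θ Γ m l)) :=
  ⟨fun l => torsionForm_eq he hθ hΓ l, fun k l => curvatureForm_eq he hθ hΓ k l⟩
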